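/- Let $Y_1, Y_2, \dots$ be i.i.d. complex-valued random variables that are non-degenerate, i.e. there is no constant $c \in \mathbb{C}$ with $Y_1 = c$ almost surely. Let $k = k(n)$ be a sequence of integers such that $1 \le k(n) \le \frac{\log n}{5 \log\log n}$ for all sufficiently large $n$. Then for every $\varepsilon > 0$, $$\lim_{n\to\infty} \mathbb{P}\left( \left| \sum_{1 \le i_1 < i_2 < \dots < i_k \le n} Y_{i_1} Y_{i_2} \cdots Y_{i_k} \right| \le e^{-\varepsilon n} \right) = 0 .$$ -/

import Mathlib

open MeasureTheory ProbabilityTheory Filter Topology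

/-!
Write `e_j` for the `j`-th elementary symmetric polynomial. The vector `(e_0, …, e_k)` of the first
`n` variables evolves by the steps `x ↦ x + y • S x`, where `S` is the coordinate shift and `y` the
next variable (`esymmVec_succ`). These steps commute, so averaging over the law `μ` of one variable
gives an operator `T_μ = avgOp k μ` that is additive in `μ`, the operators of two measures commute,
and the probability in question is the `n`-th power of `T_μ` applied to the indicator of
`|e_k| ≤ t`, evaluated at the initial vector (`lintegral_esymmVec`).

Since `μ` is not a point mass, two points at distance bounded below lie in its support, and
partitioning neighbourhoods of them into small squares yields `μ = α + β + ν` where `α` and `β` have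
the same mass `w ≥ c η²` and live in balls of radius `η` around points `a`, `b` with `|a - b| ≥ δ`
(`exists_measure_decomposition`). By the binomial theorem, `T_μ ^ n` is a mixture of the operators
`T_ν ^ (n - M) T_α ^ j T_β ^ (M - j)`, with `j` binomial given `M`.

The heart of the matter is deterministic (`card_small_le`): from any starting vector with `e_0 = 1`,
among the `N + 1` ways to perform `N` steps, `i` of them near `a` and the others near `b`, at most
`k` values of `i` can lead to a tiny `e_k`. Were all the steps exactly `a` or `b`, then `e_k` would
be a polynomial of degree at most `k` in `i`; small values at `k + 1` nodes would force small values
at all `0 ≤ i ≤ N` by Lagrange interpolation, hence a small starting vector, because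
`(a - b) ^ N S ^ r = (p - q) ^ r (a q - b p) ^ (N - r)` is a combination of the products
`p ^ i q ^ (N - i)` for `p = 1 + a S` and `q = 1 + b S`. The perturbation of size `η` is absorbed
when `η` beats `N ^ k` and exponentials in `N`.

So every window of `N + 1` consecutive values of `j` carries small-ball probability at most `k`, out
of a possible `N + 1`. The binomial weights of `j` vary slowly (`sum_choose_mul_sub_shift_le`),
hence the probability is at most `k / (N + 1) + 2 N / √(2 w (n + 1))` (`avgOp_pow_le_of_window`).
With `N = A k` and `η = n ^ (-1/3)` this tends to at most `1 / A`; the growth hypothesis on `k`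
enters through `k ^ k ≤ n ^ (1/5)` and `C ^ k = n ^ o(1)`, so that `η` is small enough.
-/

open scoped ENNReal NNReal

/-! ### Interpolation and products of linear forms -/

open Polynomial in
/-- Lagrange interpolation at `k + 1` distinct integer nodes in `[0, N]`. Differences of distinct
nodes have absolute value at least `1`, so each basis polynomial is at most `N ^ k` on `[0, N]`. -/
theorem norm_eval_le_of_nodes {k N : ℕ} {Q : ℂ[X]} (hQ : Q.natDegree ≤ k) {I : Finset ℕ}
    (hI : I ⊆ Finset.range (N + 1)) (hcard : I.card = k + 1) {m : ℝ}
    (hm : ∀ j ∈ I, ‖Q.eval (j : ℂ)‖ ≤ m) {x : ℕ} (hx : x ≤ N) :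
    ‖Q.eval (x : ℂ)‖ ≤ (k + 1) * (N : ℝ) ^ k * m := by
  have hinj : Set.InjOn (fun j : ℕ => (j : ℂ)) I := Nat.cast_injective.injOn
  have hdeg : Q.degree < I.card := by
    rw [hcard]
    exact lt_of_le_of_lt degree_le_natDegree (by exact_mod_cast Nat.lt_succ_of_le hQ)
  rw [Lagrange.eq_interpolate hinj hdeg, Lagrange.interpolate_apply, eval_finsetSum]
  refine (norm_sum_le _ _).trans ?_
  have hterm : ∀ i ∈ I, ‖(C (Q.eval (i : ℂ)) * Lagrange.basis I (fun j : ℕ => (j : ℂ)) i).eval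
      (x : ℂ)‖ ≤ (N : ℝ) ^ k * m := by
    intro i hi
    rw [eval_mul, eval_C, norm_mul, mul_comm]
    refine mul_le_mul ?_ (hm i hi) (norm_nonneg _) (by positivity)
    rw [Lagrange.basis, eval_prod, norm_prod]
    have hc : (I.erase i).card = k := by rw [Finset.card_erase_of_mem hi, hcard]; rfl
    rw [← hc, ← Finset.prod_const]
    refine Finset.prod_le_prod (fun _ _ => norm_nonneg _) fun j hj => ?_
    have hji : j ≠ i := Finset.ne_of_mem_erase hj
    have hjN : j ≤ N := by
      have := Finset.mem_range.1 (hI (Finset.mem_of_mem_erase hj)); omega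
    rw [Lagrange.basisDivisor, eval_mul, eval_C, eval_sub, eval_X, eval_C, norm_mul, norm_inv]
    have h1 : (1 : ℝ) ≤ ‖(i : ℂ) - (j : ℂ)‖ := by
      have h : (1 : ℤ) ≤ |(i : ℤ) - j| := Int.one_le_abs (by omega)
      have h' : ‖(i : ℂ) - (j : ℂ)‖ = ((|(i : ℤ) - j| : ℤ) : ℝ) := by
        rw [show (i : ℂ) - (j : ℂ) = (((i : ℤ) - j : ℤ) : ℂ) by push_cast; rfl,
          Complex.norm_intCast, Int.cast_abs]
      rw [h']; exact_mod_cast h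
    have h2 : ‖(x : ℂ) - (j : ℂ)‖ ≤ N := by
      have h : |(x : ℤ) - j| ≤ N := by rw [abs_le]; omega
      have h' : ‖(x : ℂ) - (j : ℂ)‖ = ((|(x : ℤ) - j| : ℤ) : ℝ) := by
        rw [show (x : ℂ) - (j : ℂ) = (((x : ℤ) - j : ℤ) : ℂ) by push_cast; rfl,
          Complex.norm_intCast, Int.cast_abs]
      rw [h']; exact_mod_cast h
    calc _ ≤ 1 * ‖(x : ℂ) - (j : ℂ)‖ := by
          gcongr; exact inv_le_one_of_one_le₀ h1
      _ ≤ N := by rw [one_mul]; exact h2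
  refine (Finset.sum_le_sum hterm).trans ?_
  rw [Finset.sum_const, hcard, nsmul_eq_mul]
  push_cast
  exact le_of_eq (by ring)

/-- A bound for a functional on all products `p ^ i * q ^ j` with `i + j = N` propagates to products
of `N` linear forms in `p` and `q`. -/
theorem norm_map_products_le {A : Type*} [CommRing A] [Algebra ℂ A] (Λ : A →ₗ[ℂ] ℂ) (p q : A)
    {a b : ℂ} {R B : ℝ} (ha : ‖a‖ ≤ R) (hb : ‖b‖ ≤ R) {N : ℕ}
    (h : ∀ i j, i + j = N → ‖Λ (p ^ i * q ^ j)‖ ≤ B) (r : ℕ) :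
    ∀ s i j, r + s + i + j = N →
      ‖Λ ((p - q) ^ r * (a • q - b • p) ^ s * (p ^ i * q ^ j))‖ ≤ 2 ^ r * (2 * R) ^ s * B := by
  have hR : 0 ≤ R := (norm_nonneg a).trans ha
  induction r with
  | zero =>
    intro s
    induction s with
    | zero => intro i j hij; simpa using h i j (by omega)
    | succ s ih =>
      intro i j hij
      have e : (p - q) ^ 0 * (a • q - b • p) ^ (s + 1) * (p ^ i * q ^ j) =
          a • ((p - q) ^ 0 * (a • q - b • p) ^ s * (p ^ i * q ^ (j + 1))) -
          b • ((p - q) ^ 0 * (a • q - b • p) ^ s * (p ^ (i + 1) * q ^ j)) := by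
        simp only [Algebra.smul_def]; ring
      rw [e, map_sub, map_smul, map_smul, smul_eq_mul, smul_eq_mul]
      have h1 := ih i (j + 1) (by omega)
      have h2 := ih (i + 1) j (by omega)
      calc _ ≤ ‖a‖ * _ + ‖b‖ * _ := by
            refine (norm_sub_le _ _).trans ?_; rw [norm_mul, norm_mul]
        _ ≤ R * (2 ^ 0 * (2 * R) ^ s * B) + R * (2 ^ 0 * (2 * R) ^ s * B) := by
            gcongr
        _ = _ := by ring
  | succ r ih =>
    intro s i j hij
    have e : (p - q) ^ (r + 1) * (a • q - b • p) ^ s * (p ^ i * q ^ j) =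
        (p - q) ^ r * (a • q - b • p) ^ s * (p ^ (i + 1) * q ^ j) -
        (p - q) ^ r * (a • q - b • p) ^ s * (p ^ i * q ^ (j + 1)) := by ring
    rw [e, map_sub]
    have h1 := ih s i (j + 1) (by omega)
    have h2 := ih s (i + 1) j (by omega)
    calc _ ≤ _ := norm_sub_le _ _
      _ ≤ _ := add_le_add h2 h1
      _ = _ := by ring

/-! ### The coordinate shift and the steps of elementary symmetric polynomials -/

/-- The nilpotent shift `(x_0, …, x_k) ↦ (0, x_0, …, x_{k-1})`. -/
def shiftOp (k : ℕ) : Module.End ℂ (Fin (k + 1) → ℂ) where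
  toFun x := Fin.cons 0 (Fin.init x)
  map_add' x y := by
    ext j; refine Fin.cases ?_ (fun i => ?_) j <;> simp [Fin.init]
  map_smul' c x := by
    ext j; refine Fin.cases ?_ (fun i => ?_) j <;> simp [Fin.init]

theorem norm_shiftOp_le {k : ℕ} (x : Fin (k + 1) → ℂ) : ‖shiftOp k x‖ ≤ ‖x‖ := by
  rw [pi_norm_le_iff_of_nonneg (norm_nonneg x)]
  intro j
  refine Fin.cases ?_ (fun i => ?_) j
  · simp [shiftOp]
  · simpa [shiftOp, Fin.init] using norm_le_pi_norm x i.castSucc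

theorem shiftOp_pow_apply {k : ℕ} (r : ℕ) (x : Fin (k + 1) → ℂ) (j : Fin (k + 1)) :
    (shiftOp k ^ r) x j = if h : r ≤ (j : ℕ) then x ⟨j - r, by omega⟩ else 0 := by
  induction r generalizing j with
  | zero => simp
  | succ r ih =>
    rw [pow_succ', Module.End.mul_apply]
    refine Fin.cases ?_ (fun i => ?_) j
    · simp [shiftOp]
    · simp only [shiftOp, LinearMap.coe_mk, AddHom.coe_mk, Fin.cons_succ, Fin.init]
      have := ih i.castSucc
      simp only [shiftOp] at this
      rw [this]
      by_cases h : r ≤ (i : ℕ)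
      · simp [h]
      · simp [h]

/-- The effect on `(e_0, …, e_k)` of adjoining a variable with value `y`:
`e_j` becomes `e_j + y e_{j-1}`. -/
def esymmStep (k : ℕ) (y : ℂ) (x : Fin (k + 1) → ℂ) : Fin (k + 1) → ℂ := x + y • shiftOp k x

/-- Steps along a list of values within `η` of `a` differ little from equally many steps with value
`a`, even from a slightly different starting vector. -/
theorem norm_foldl_esymmStep_sub_le {k : ℕ} {a : ℂ} {R η : ℝ} (ha : ‖a‖ ≤ R) (hη : η ≤ 1)
    (us : List ℂ) (hus : ∀ u ∈ us, ‖u - a‖ ≤ η) :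
    ∀ x x' : Fin (k + 1) → ℂ,
      ‖us.foldl (fun x y => esymmStep k y x) x - ((1 + a • shiftOp k) ^ us.length) x'‖ ≤
        (2 + R) ^ us.length * (‖x - x'‖ + us.length * η * ‖x'‖) := by
  have hR : 0 ≤ R := (norm_nonneg a).trans ha
  induction us with
  | nil => intro x x'; simp
  | cons y us ih =>
    intro x x'
    have hy : ‖y - a‖ ≤ η := hus y (by simp)
    have hη0 : 0 ≤ η := (norm_nonneg _).trans hy
    have hy' : ‖y‖ ≤ 1 + R := by
      calc ‖y‖ = ‖(y - a) + a‖ := by ring_nf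
        _ ≤ _ := (norm_add_le _ _).trans (by linarith)
    have := ih (fun u hu => hus u (by simp [hu])) (esymmStep k y x) ((1 + a • shiftOp k) x')
    rw [List.foldl_cons, List.length_cons, pow_succ, Module.End.mul_apply]
    refine this.trans ?_
    rw [pow_succ (2 + R), mul_assoc ((2 + R) ^ us.length) (2 + R)]
    refine mul_le_mul_of_nonneg_left ?_ (by positivity)
    have e : esymmStep k y x - (1 + a • shiftOp k : Module.End ℂ (Fin (k + 1) → ℂ)) x' =
        ((x - x') + y • shiftOp k (x - x')) + (y - a) • shiftOp k x' := by
      simp only [esymmStep, LinearMap.add_apply, Module.End.one_apply, LinearMap.smul_apply,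
        map_sub, smul_sub, sub_smul]
      abel
    have h1 : ‖esymmStep k y x - (1 + a • shiftOp k) x'‖ ≤
        (2 + R) * ‖x - x'‖ + η * ‖x'‖ := by
      rw [e]
      calc _ ≤ ‖x - x'‖ + ‖y‖ * ‖shiftOp k (x - x')‖ + ‖y - a‖ * ‖shiftOp k x'‖ := by
            refine (norm_add_le _ _).trans ?_
            rw [norm_smul]
            gcongr
            refine (norm_add_le _ _).trans ?_
            rw [norm_smul]
        _ ≤ ‖x - x'‖ + (1 + R) * ‖x - x'‖ + η * ‖x'‖ := by
            gcongr <;> exact norm_shiftOp_le _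
        _ = _ := by ring
    have h2 : ‖(1 + a • shiftOp k) x'‖ ≤ (1 + R) * ‖x'‖ := by
      simp only [LinearMap.add_apply, Module.End.one_apply, LinearMap.smul_apply]
      calc _ ≤ ‖x'‖ + ‖a‖ * ‖shiftOp k x'‖ := by
            refine (norm_add_le _ _).trans ?_; rw [norm_smul]
        _ ≤ ‖x'‖ + R * ‖x'‖ := by gcongr; exact norm_shiftOp_le _
        _ = _ := by ring
    push_cast
    calc _ ≤ (2 + R) * ‖x - x'‖ + η * ‖x'‖ + us.length * η * ((1 + R) * ‖x'‖) := by gcongr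
      _ ≤ _ := by
        have : 0 ≤ η * ‖x'‖ := by positivity
        have : 0 ≤ us.length * (η * ‖x'‖) := by positivity
        nlinarith

theorem norm_one_add_smul_shiftOp_pow_le {k : ℕ} {a : ℂ} {R : ℝ} (ha : ‖a‖ ≤ R) (i : ℕ)
    (x : Fin (k + 1) → ℂ) : ‖((1 + a • shiftOp k) ^ i) x‖ ≤ (2 + R) ^ i * ‖x‖ := by
  have hR : 0 ≤ R := (norm_nonneg a).trans ha
  have h0 : (List.replicate i a).foldl (fun x y => esymmStep k y x) (0 : Fin (k + 1) → ℂ) =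
      (0 : Fin (k + 1) → ℂ) := by
    induction i with
    | zero => rfl
    | succ i ih => simpa [List.replicate_succ, esymmStep] using ih
  have := norm_foldl_esymmStep_sub_le (k := k) (η := 0) ha zero_le_one (List.replicate i a)
    (by simp) 0 x
  simpa [h0] using this

open Polynomial in
/-- The functional `P ↦ (P(S) x)_k` on polynomials, for `S` the coordinate shift. Polynomials are
used to have a commutative algebra acting on the vector `x`. -/
noncomputable def lastCoord (k : ℕ) (x : Fin (k + 1) → ℂ) : ℂ[X] →ₗ[ℂ] ℂ :=
  (LinearMap.proj (Fin.last k)).comp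
    ((LinearMap.applyₗ x).comp (aeval (shiftOp k)).toLinearMap)

theorem lastCoord_apply {k : ℕ} (x : Fin (k + 1) → ℂ) (P : Polynomial ℂ) :
    lastCoord k x P = Polynomial.aeval (shiftOp k) P x (Fin.last k) := rfl

theorem lastCoord_X_pow {k r : ℕ} (x : Fin (k + 1) → ℂ) (hr : r ≤ k) :
    lastCoord k x (Polynomial.X ^ r) = x ⟨k - r, by omega⟩ := by
  rw [lastCoord_apply, map_pow, Polynomial.aeval_X, shiftOp_pow_apply, dif_pos (by simpa)]
  rfl

theorem lastCoord_eq_zero {k r : ℕ} (x : Fin (k + 1) → ℂ) (hr : k < r) (P : Polynomial ℂ) :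
    lastCoord k x (Polynomial.X ^ r * P) = 0 := by
  rw [lastCoord_apply, map_mul, map_pow, Polynomial.aeval_X, Module.End.mul_apply,
    shiftOp_pow_apply, dif_neg (by simpa)]

open Polynomial in
/-- The last coordinates of `p ^ i q ^ (N - i) x`, `0 ≤ i ≤ N`, with `p = 1 + a S` and `q = 1 + b S`,
control all of `x`: its coordinates are those of `S ^ r x`, and `p - q = (a - b) S`,
`a q - b p = a - b`. -/
theorem norm_mul_pow_le_of_values {k N : ℕ} (hkN : k ≤ N) {a b : ℂ} {R B : ℝ} (hR : 1 ≤ R)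
    (ha : ‖a‖ ≤ R) (hb : ‖b‖ ≤ R) (x : Fin (k + 1) → ℂ)
    (h : ∀ i j, i + j = N → ‖lastCoord k x ((1 + a • X) ^ i * (1 + b • X) ^ j)‖ ≤ B) :
    ‖x‖ * ‖a - b‖ ^ N ≤ (2 * R) ^ N * B := by
  have hB : 0 ≤ B := (norm_nonneg _).trans (h N 0 rfl)
  have key := norm_map_products_le (lastCoord k x) _ _ ha hb h
  have e1 : (1 + a • X : ℂ[X]) - (1 + b • X) = C (a - b) * X := by
    simp only [smul_eq_C_mul, C_sub]; ring
  have e2 : a • (1 + b • X : ℂ[X]) - b • (1 + a • X) = C (a - b) := by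
    simp only [smul_eq_C_mul, C_sub]; ring
  have hx : ∀ j : Fin (k + 1), ‖a - b‖ ^ N * ‖x j‖ ≤ (2 * R) ^ N * B := by
    intro j
    have hj : (j : ℕ) ≤ k := by omega
    have h1 := key (k - j) (N - (k - j)) 0 0 (by omega)
    have e3 : (C (a - b) * X) ^ (k - (j : ℕ)) * C (a - b) ^ (N - (k - j)) *
        ((1 + a • X) ^ 0 * (1 + b • X) ^ 0) = (a - b) ^ N • (X : ℂ[X]) ^ (k - (j : ℕ)) := by
      have : N = (k - j) + (N - (k - j)) := by omega
      conv_rhs => rw [this]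
      simp only [smul_eq_C_mul, C_pow]
      ring
    have e4 : (⟨k - (k - (j : ℕ)), by omega⟩ : Fin (k + 1)) = j := Fin.ext (by simp; omega)
    rw [e1, e2, e3, map_smul, lastCoord_X_pow x (by omega), e4, smul_eq_mul, norm_mul,
      norm_pow] at h1
    refine h1.trans ?_
    calc _ ≤ (2 * R) ^ (k - (j : ℕ)) * (2 * R) ^ (N - (k - j)) * B := by
          gcongr; linarith
      _ = _ := by rw [← pow_add]; congr 2; omega
  have : ‖((‖a - b‖ ^ N : ℝ) : ℂ) • x‖ ≤ (2 * R) ^ N * B := by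
    rw [pi_norm_le_iff_of_nonneg (by positivity)]
    intro j
    rw [Pi.smul_apply, norm_smul, Complex.norm_real, Real.norm_of_nonneg (by positivity)]
    exact hx j
  rwa [norm_smul, Complex.norm_real, Real.norm_of_nonneg (by positivity), mul_comm] at this

open Polynomial in
/-- By Newton expansion of `p = q + (a - b) S`, and as `S ^ (k + 1) = 0`, the last coordinate of
`p ^ i q ^ (N - i) x` is a polynomial of degree at most `k` in `i`. -/
theorem exists_polynomial_eval_eq_lastCoord {k N : ℕ} (a b : ℂ) (x : Fin (k + 1) → ℂ) :
    ∃ Q : ℂ[X], Q.natDegree ≤ k ∧ ∀ i j, i + j = N →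
      Q.eval (i : ℂ) = lastCoord k x ((1 + a • X) ^ i * (1 + b • X) ^ j) := by
  set c : ℕ → ℂ := fun r => lastCoord k x ((C (a - b) * X) ^ r * (1 + b • X) ^ (N - r)) with hc
  refine ⟨∑ r ∈ Finset.range (k + 1), C (c r / r.factorial) * descPochhammer ℂ r, ?_, ?_⟩
  · refine natDegree_sum_le_of_forall_le _ _ fun r hr => ?_
    refine (natDegree_C_mul_le _ _).trans ?_
    rw [descPochhammer_natDegree]
    exact Nat.lt_succ_iff.1 (Finset.mem_range.1 hr)
  · intro i j hij
    have e1 : (1 + a • X : ℂ[X]) = C (a - b) * X + (1 + b • X) := by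
      simp only [smul_eq_C_mul, C_sub]; ring
    have hterm : ∀ r, (C (c r / r.factorial) * descPochhammer ℂ r).eval (i : ℂ) =
        i.choose r * c r := by
      intro r
      rw [eval_mul, eval_C, descPochhammer_eval_eq_descFactorial,
        Nat.descFactorial_eq_factorial_mul_choose]
      have : (r.factorial : ℂ) ≠ 0 := by exact_mod_cast r.factorial_ne_zero
      push_cast
      field_simp
    have hvan : ∀ r, k < r → c r = 0 := by
      intro r hr
      rw [hc]
      simp only
      rw [mul_pow, mul_assoc, mul_left_comm]
      exact lastCoord_eq_zero x hr _
    rw [eval_finsetSum, Finset.sum_congr rfl fun r _ => hterm r, e1, add_pow, Finset.sum_mul,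
      map_sum]
    have hR : ∀ r ∈ Finset.range (i + 1), lastCoord k x ((C (a - b) * X) ^ r *
        (1 + b • X) ^ (i - r) * (i.choose r : ℂ[X]) * (1 + b • X) ^ j) = i.choose r * c r := by
      intro r hr
      have hr' : r ≤ i := Nat.lt_succ_iff.1 (Finset.mem_range.1 hr)
      rw [hc]
      simp only
      rw [← smul_eq_mul (i.choose r : ℂ), ← map_smul]
      congr 1
      rw [show N - r = (i - r) + j by omega, pow_add, smul_eq_C_mul,
        smul_eq_C_mul, C_eq_natCast]
      ring
    rw [Finset.sum_congr rfl hR]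
    rcases le_total i k with h | h
    · symm
      refine Finset.sum_subset (Finset.range_mono (by omega)) fun r _ hr => ?_
      rw [Nat.choose_eq_zero_of_lt (by simpa using hr)]; simp
    · refine Finset.sum_subset (Finset.range_mono (by omega)) fun r _ hr => ?_
      rw [hvan r (by simpa using hr)]; simp

/-- Starting from a vector with `e_0 = 1`, take `i` steps with values near `a` and `N - i` steps with
values near `b`. The last coordinate can be tiny for at most `k` numbers `i`. The values chosen for
different `i` need not be related. -/
theorem card_small_le {k N : ℕ} (hkN : k ≤ N) {a b : ℂ} {R δ η t : ℝ} (hR : 1 ≤ R)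
    (ha : ‖a‖ ≤ R) (hb : ‖b‖ ≤ R) (hδ : 0 < δ) (hab : δ ≤ ‖a - b‖) (hη0 : 0 ≤ η) (hη : η ≤ 1)
    (ht : t ≤ η)
    (hsmall : (2 * R) ^ N * ((k + 1) * (N : ℝ) ^ k * ((1 + (2 + R) ^ N * N) * η)) < δ ^ N)
    {x : Fin (k + 1) → ℂ} (hx : x 0 = 1) {I : Finset ℕ} (hIN : I ⊆ Finset.range (N + 1))
    (hI : ∀ i ∈ I, ∃ us vs : List ℂ, us.length = i ∧ vs.length = N - i ∧
      (∀ u ∈ us, ‖u - a‖ ≤ η) ∧ (∀ v ∈ vs, ‖v - b‖ ≤ η) ∧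
      ‖vs.foldl (fun x y => esymmStep k y x) (us.foldl (fun x y => esymmStep k y x) x)
        (Fin.last k)‖ ≤ t) :
    I.card ≤ k := by
  by_contra! hcard
  obtain ⟨J, hJI, hJ⟩ := Finset.exists_subset_card_eq hcard
  have hx1 : 1 ≤ ‖x‖ := by simpa [hx] using norm_le_pi_norm x 0
  obtain ⟨Q, hQd, hQ⟩ := exists_polynomial_eval_eq_lastCoord (N := N) a b x
  have hR0 : 0 ≤ R := by linarith
  have hnode : ∀ i ∈ J, ‖Q.eval (i : ℂ)‖ ≤ (1 + (2 + R) ^ N * N) * η * ‖x‖ := by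
    intro i hi
    obtain ⟨us, vs, hus, hvs, hua, hvb, hsm⟩ := hI i (hJI hi)
    have hiN : i ≤ N := Nat.lt_succ_iff.1 (Finset.mem_range.1 (hIN (hJI hi)))
    rw [hQ i (N - i) (by omega), lastCoord_apply]
    have e : Polynomial.aeval (shiftOp k) ((1 + a • Polynomial.X) ^ i *
        (1 + b • Polynomial.X) ^ (N - i) : Polynomial ℂ) x =
        ((1 + b • shiftOp k) ^ (N - i)) (((1 + a • shiftOp k) ^ i) x) := by
      rw [mul_comm]; simp [Module.End.mul_apply]
    rw [e]
    set z := ((1 + a • shiftOp k) ^ i) x with hz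
    set w := us.foldl (fun x y => esymmStep k y x) x with hw
    have h1 := norm_foldl_esymmStep_sub_le ha hη us hua x x
    rw [sub_self, norm_zero, zero_add, hus, ← hz, ← hw] at h1
    have h2 := norm_foldl_esymmStep_sub_le hb hη vs hvb w z
    rw [hvs] at h2
    have h3 : ‖z‖ ≤ (2 + R) ^ i * ‖x‖ := norm_one_add_smul_shiftOp_pow_le ha i x
    set v := vs.foldl (fun x y => esymmStep k y x) w
    set v' := ((1 + b • shiftOp k) ^ (N - i)) z
    have h4 : ‖v - v'‖ ≤ (2 + R) ^ N * N * η * ‖x‖ := by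
      calc _ ≤ _ := h2
        _ ≤ (2 + R) ^ (N - i) * ((2 + R) ^ i * (i * η * ‖x‖) +
            ((N - i : ℕ) : ℝ) * η * ((2 + R) ^ i * ‖x‖)) := by gcongr
        _ = (2 + R) ^ (N - i + i) * (((i + (N - i) : ℕ) : ℝ) * η * ‖x‖) := by
            push_cast; ring
        _ = _ := by
            rw [show N - i + i = N by omega, show i + (N - i) = N by omega]; ring
    have h5 : ‖(v - v') (Fin.last k)‖ ≤ ‖v - v'‖ := norm_le_pi_norm _ _
    calc ‖v' (Fin.last k)‖ = ‖v (Fin.last k) - (v - v') (Fin.last k)‖ := by simp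
      _ ≤ ‖v (Fin.last k)‖ + ‖(v - v') (Fin.last k)‖ := norm_sub_le _ _
      _ ≤ η * ‖x‖ + (2 + R) ^ N * N * η * ‖x‖ := by
        have : η ≤ η * ‖x‖ := le_mul_of_one_le_right hη0 hx1
        linarith
      _ = _ := by ring
  -- `norm_mul_pow_le_of_values` bounds `‖x‖` by a small multiple of `‖x‖` itself,
  -- the error terms in `hnode` being proportional to `‖x‖`
  have hvals := norm_mul_pow_le_of_values hkN hR ha hb x (fun i j hij => by
    rw [← hQ i j hij]
    exact norm_eval_le_of_nodes hQd (hJI.trans hIN) hJ hnode (by omega))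
  have h6 : ‖x‖ * δ ^ N ≤ ‖x‖ * ‖a - b‖ ^ N := by gcongr
  have h7 := mul_lt_mul_of_pos_left hsmall (lt_of_lt_of_le one_pos hx1)
  nlinarith

/-! ### Slow variation of binomial weights -/

/-- The second moment of a sum of `m` independent signs. -/
theorem sum_choose_mul_sq_sub (m : ℕ) :
    ∑ j ∈ Finset.range (m + 1), (m.choose j : ℝ) * ((m : ℝ) - 2 * j) ^ 2 = (m : ℝ) * 2 ^ m := by
  have h := congrArg (Polynomial.eval (1 / 2 : ℝ)) (bernsteinPolynomial.variance ℝ m)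
  rw [Polynomial.eval_finsetSum] at h
  simp [bernsteinPolynomial] at h
  have h2 : ∀ j ∈ Finset.range (m + 1), (m.choose j : ℝ) * ((m : ℝ) - 2 * j) ^ 2 =
      4 * 2 ^ m * ((m * (2 : ℝ)⁻¹ - j) ^ 2 * (m.choose j * (2 ^ j)⁻¹ * (1 - 2⁻¹) ^ (m - j))) := by
    intro j hj
    have hj' : j ≤ m := Nat.lt_succ_iff.1 (Finset.mem_range.1 hj)
    have : (2 : ℝ) ^ m = 2 ^ j * 2 ^ (m - j) := by rw [← pow_add]; congr 1; omega
    rw [this, show (1 - 2⁻¹ : ℝ) = 2⁻¹ by norm_num, inv_pow]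
    field_simp
    ring
  rw [Finset.sum_congr rfl h2, ← Finset.mul_sum, h]
  ring

theorem sum_choose_mul_abs_sub_le (m : ℕ) :
    ∑ j ∈ Finset.range (m + 1), (m.choose j : ℝ) * |(m : ℝ) - 2 * j| ≤ √m * 2 ^ m := by
  have hcs := Finset.sum_mul_sq_le_sq_mul_sq (Finset.range (m + 1))
    (fun j => √(m.choose j : ℝ)) (fun j => √(m.choose j : ℝ) * |(m : ℝ) - 2 * j|)
  have e1 : ∀ j, √(m.choose j : ℝ) * (√(m.choose j : ℝ) * |(m : ℝ) - 2 * j|) =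
      m.choose j * |(m : ℝ) - 2 * j| := fun j => by
    rw [← mul_assoc, Real.mul_self_sqrt (by positivity)]
  have e2 : ∀ j, (√(m.choose j : ℝ) * |(m : ℝ) - 2 * j|) ^ 2 =
      m.choose j * ((m : ℝ) - 2 * j) ^ 2 := fun j => by
    rw [mul_pow, Real.sq_sqrt (by positivity), sq_abs]
  have e3 : ∀ j, √(m.choose j : ℝ) ^ 2 = m.choose j := fun j => Real.sq_sqrt (by positivity)
  simp only [e1, e2, e3] at hcs
  rw [sum_choose_mul_sq_sub, show ∑ j ∈ Finset.range (m + 1), (m.choose j : ℝ) = 2 ^ m by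
    exact_mod_cast Nat.sum_range_choose m] at hcs
  refine le_of_abs_le (abs_le_of_sq_le_sq ?_ (by positivity))
  rw [mul_pow, Real.sq_sqrt (by positivity)]
  linarith

/-- Shifting a bounded sequence by one changes its binomial average by `O(1 / √M)`. -/
theorem sum_choose_mul_sub_shift_le {q : ℝ} (M : ℕ) (z : ℕ → ℝ) (h0 : ∀ j, 0 ≤ z j)
    (h1 : ∀ j, z j ≤ q) :
    ∑ j ∈ Finset.range (M + 1), (M.choose j : ℝ) * z j ≤
      ∑ j ∈ Finset.range (M + 1), (M.choose j : ℝ) * z (j + 1) + 2 * q * 2 ^ M / √(M + 1) := by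
  have hM : (0 : ℝ) < M + 1 := by positivity
  have hq : 0 ≤ q := (h0 0).trans (h1 0)
  -- `M.choose j` and `M.choose (j - 1)` are the fractions `(M + 1 - j) / (M + 1)` and `j / (M + 1)`
  -- of `(M + 1).choose j`, which turns the difference into a mean absolute deviation
  have eA : ∑ j ∈ Finset.range (M + 1), (M.choose j : ℝ) * z j =
      ∑ j ∈ Finset.range (M + 2), ((M + 1).choose j : ℝ) * ((M + 1 - j) / (M + 1)) * z j := by
    rw [Finset.sum_range_succ _ (M + 1)]
    push_cast
    rw [sub_self, zero_div, mul_zero, zero_mul, add_zero]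
    refine Finset.sum_congr rfl fun j hj => ?_
    have hj' : j ≤ M + 1 := (Finset.mem_range.1 hj).le
    have h := Nat.choose_mul_succ_eq M j
    have h' : (M.choose j : ℝ) * (M + 1) = (M + 1).choose j * (M + 1 - j) := by
      have := congrArg (Nat.cast (R := ℝ)) h
      push_cast [Nat.cast_sub hj'] at this
      exact this
    congr 1
    field_simp
    exact h'
  have eB : ∑ j ∈ Finset.range (M + 1), (M.choose j : ℝ) * z (j + 1) =
      ∑ j ∈ Finset.range (M + 2), ((M + 1).choose j : ℝ) * (j / (M + 1)) * z j := by
    rw [Finset.sum_range_succ' _ (M + 1)]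
    push_cast
    rw [zero_div, mul_zero, zero_mul, add_zero]
    refine Finset.sum_congr rfl fun j hj => ?_
    have h := Nat.add_one_mul_choose_eq M j
    have h' : ((M : ℝ) + 1) * M.choose j = (M + 1).choose (j + 1) * (j + 1) := by
      exact_mod_cast h
    congr 1
    field_simp
    linarith
  have hV := sum_choose_mul_abs_sub_le (M + 1)
  have hmain : ∑ j ∈ Finset.range (M + 1), (M.choose j : ℝ) * z j -
      ∑ j ∈ Finset.range (M + 1), (M.choose j : ℝ) * z (j + 1) ≤
      q / (M + 1) * ∑ j ∈ Finset.range (M + 1 + 1), ((M + 1).choose j : ℝ) *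
        |((M + 1 : ℕ) : ℝ) - 2 * j| := by
    rw [eA, eB, ← Finset.sum_sub_distrib, Finset.mul_sum]
    refine Finset.sum_le_sum fun j _ => ?_
    push_cast
    calc _ = ((M + 1).choose j : ℝ) / (M + 1) * ((M + 1 - 2 * j) * z j) := by field_simp; ring
      _ ≤ ((M + 1).choose j : ℝ) / (M + 1) * (|(M + 1 : ℝ) - 2 * j| * q) := by
        gcongr
        · exact h0 j
        · exact le_abs_self _
        · exact h1 j
      _ = _ := by ring
  have hs : √((M + 1 : ℕ) : ℝ) / (M + 1) = 1 / √(M + 1 : ℝ) := by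
    push_cast
    rw [div_eq_div_iff hM.ne' (by positivity), Real.mul_self_sqrt hM.le, one_mul]
  have : q / (M + 1) * ∑ j ∈ Finset.range (M + 1 + 1), ((M + 1).choose j : ℝ) *
        |((M + 1 : ℕ) : ℝ) - 2 * j| ≤ 2 * q * 2 ^ M / √(M + 1) := by
    calc _ ≤ q / (M + 1) * (√((M + 1 : ℕ) : ℝ) * 2 ^ (M + 1)) := by gcongr
      _ = q * 2 ^ (M + 1) * (√((M + 1 : ℕ) : ℝ) / (M + 1)) := by ring
      _ = _ := by rw [hs]; ring
  linarith

/-- A sequence with values in `[0, q]` whose sum over every window of length `N + 1` is at most `k q`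
has binomial average at most about `k q / (N + 1)`. -/
theorem sum_choose_mul_le_of_window {q : ℝ} {k N : ℕ} (M : ℕ) (y : ℕ → ℝ) (h0 : ∀ j, 0 ≤ y j)
    (h1 : ∀ j, y j ≤ q)
    (hw : ∀ s, ∑ i ∈ Finset.range (N + 1), y (s + i) ≤ k * q) :
    ∑ j ∈ Finset.range (M + 1), (M.choose j : ℝ) * y j ≤
      2 ^ M * q * (k / (N + 1) + 2 * N / √(M + 1)) := by
  have hq : 0 ≤ q := (h0 0).trans (h1 0)
  set D : ℕ → ℝ := fun i => ∑ j ∈ Finset.range (M + 1), (M.choose j : ℝ) * y (j + i) with hD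
  set e : ℝ := 2 * q * 2 ^ M / √(M + 1) with he
  have he0 : 0 ≤ e := by positivity
  have hstep : ∀ i, D 0 ≤ D i + i * e := by
    intro i
    induction i with
    | zero => simp
    | succ i ih =>
      have := sum_choose_mul_sub_shift_le (q := q) M (fun j => y (j + i)) (fun j => h0 _)
        (fun j => h1 _)
      have e2 : ∀ j, y (j + 1 + i) = y (j + (i + 1)) := fun j => by congr 1; ring
      simp only [e2] at this
      push_cast
      simp only [hD] at ih ⊢
      linarith
  have hsum : ∑ i ∈ Finset.range (N + 1), D i ≤ 2 ^ M * (k * q) := by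
    rw [hD, Finset.sum_comm]
    simp only [← Finset.mul_sum]
    calc _ ≤ ∑ j ∈ Finset.range (M + 1), (M.choose j : ℝ) * (k * q) :=
          Finset.sum_le_sum fun j _ => mul_le_mul_of_nonneg_left (hw j) (by positivity)
      _ = _ := by
        rw [← Finset.sum_mul]; congr 1; exact_mod_cast Nat.sum_range_choose M
  have hall : (N + 1) * D 0 ≤ 2 ^ M * (k * q) + (N + 1) * (N * e) := by
    calc (N + 1) * D 0 = ∑ i ∈ Finset.range (N + 1), D 0 := by simp
      _ ≤ ∑ i ∈ Finset.range (N + 1), (D i + N * e) := by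
        refine Finset.sum_le_sum fun i hi => (hstep i).trans ?_
        have : (i : ℝ) ≤ N := by exact_mod_cast Nat.lt_succ_iff.1 (Finset.mem_range.1 hi)
        gcongr
      _ = ∑ i ∈ Finset.range (N + 1), D i + (N + 1) * (N * e) := by
        rw [Finset.sum_add_distrib]; simp
      _ ≤ _ := by gcongr
  have hN : (0 : ℝ) < N + 1 := by positivity
  have : D 0 ≤ 2 ^ M * q * (k / (N + 1) + 2 * N / √(M + 1)) := by
    rw [← mul_le_mul_iff_right₀ hN]
    refine hall.trans (le_of_eq ?_)
    rw [he]; field_simp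
  simpa [hD] using this

theorem sum_binomial_inv_le {n : ℕ} {q r : ℝ} (hq : 0 < q) (hr : 0 ≤ r) (hqr : q + r = 1) :
    ∑ M ∈ Finset.range (n + 1), (n.choose M : ℝ) * q ^ M * r ^ (n - M) * (1 / (M + 1)) ≤
      1 / (q * (n + 1)) := by
  have hn : (0 : ℝ) < n + 1 := by positivity
  have h : ∑ M ∈ Finset.range (n + 1), ((n + 1).choose (M + 1) : ℝ) * q ^ (M + 1) *
      r ^ (n + 1 - (M + 1)) ≤ 1 := by
    calc _ ≤ ∑ M ∈ Finset.range (n + 2), ((n + 1).choose M : ℝ) * q ^ M * r ^ (n + 1 - M) := by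
          rw [Finset.sum_range_succ' _ (n + 1)]
          have : 0 ≤ ((n + 1).choose 0 : ℝ) * q ^ 0 * r ^ (n + 1 - 0) := by positivity
          linarith
      _ = (q + r) ^ (n + 1) := by
          rw [add_pow]; exact Finset.sum_congr rfl fun M _ => by ring
      _ = 1 := by rw [hqr, one_pow]
  have e : ∀ M ∈ Finset.range (n + 1), (n.choose M : ℝ) * q ^ M * r ^ (n - M) * (1 / (M + 1)) =
      1 / (q * (n + 1)) * (((n + 1).choose (M + 1) : ℝ) * q ^ (M + 1) *
        r ^ (n + 1 - (M + 1))) := by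
    intro M _
    have h' : ((n : ℝ) + 1) * n.choose M = (n + 1).choose (M + 1) * (M + 1) := by
      exact_mod_cast Nat.add_one_mul_choose_eq n M
    have hM : (0 : ℝ) < M + 1 := by positivity
    rw [Nat.add_sub_add_right, show (n.choose M : ℝ) =
      (n + 1).choose (M + 1) * (M + 1) / (n + 1) by rw [← h']; field_simp]
    field_simp
    ring
  rw [Finset.sum_congr rfl e, ← Finset.mul_sum]
  exact mul_le_of_le_one_right (by positivity) h

theorem sum_binomial_inv_sqrt_le {n : ℕ} {q r : ℝ} (hq : 0 < q) (hr : 0 ≤ r) (hqr : q + r = 1) :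
    ∑ M ∈ Finset.range (n + 1), (n.choose M : ℝ) * q ^ M * r ^ (n - M) * (1 / √(M + 1)) ≤
      1 / √(q * (n + 1)) := by
  set ρ := √(q * (n + 1)) with hρ
  have hρ0 : 0 < ρ := Real.sqrt_pos.2 (by positivity)
  have hρ2 : ρ ^ 2 = q * (n + 1) := Real.sq_sqrt (by positivity)
  -- arithmetic-geometric mean inequality between `1 / ρ` and `ρ / (M + 1)`
  have hamgm : ∀ M : ℕ, 1 / √((M : ℝ) + 1) ≤ 1 / (2 * ρ) + ρ / 2 * (1 / (M + 1)) := by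
    intro M
    have hs : 0 < √((M : ℝ) + 1) := Real.sqrt_pos.2 (by positivity)
    have hs2 : √((M : ℝ) + 1) ^ 2 = M + 1 := Real.sq_sqrt (by positivity)
    have : 1 / (2 * ρ) + ρ / 2 * (1 / √((M : ℝ) + 1) ^ 2) - 1 / √((M : ℝ) + 1) =
        (√((M : ℝ) + 1) - ρ) ^ 2 / (2 * ρ * √((M : ℝ) + 1) ^ 2) := by
      field_simp; ring
    have h2 : 0 ≤ (√((M : ℝ) + 1) - ρ) ^ 2 / (2 * ρ * √((M : ℝ) + 1) ^ 2) := by positivity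
    rw [hs2] at this h2
    linarith
  have hone : ∑ M ∈ Finset.range (n + 1), (n.choose M : ℝ) * q ^ M * r ^ (n - M) = 1 := by
    have := add_pow q r n
    rw [hqr, one_pow] at this
    rw [this]; exact Finset.sum_congr rfl fun M _ => by ring
  calc _ ≤ ∑ M ∈ Finset.range (n + 1), (n.choose M : ℝ) * q ^ M * r ^ (n - M) *
        (1 / (2 * ρ) + ρ / 2 * (1 / (M + 1))) := by
        gcongr with M; exact hamgm M
    _ = 1 / (2 * ρ) * ∑ M ∈ Finset.range (n + 1), (n.choose M : ℝ) * q ^ M * r ^ (n - M) +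
        ρ / 2 * ∑ M ∈ Finset.range (n + 1),
          (n.choose M : ℝ) * q ^ M * r ^ (n - M) * (1 / (M + 1)) := by
        rw [Finset.mul_sum, Finset.mul_sum, ← Finset.sum_add_distrib]
        exact Finset.sum_congr rfl fun M _ => by ring
    _ ≤ 1 / (2 * ρ) * 1 + ρ / 2 * (1 / ρ ^ 2) := by
        rw [hone, hρ2]
        gcongr
        exact sum_binomial_inv_le hq hr hqr
    _ = 1 / ρ := by field_simp; ring

/-! ### Averaging operators -/

/-- Measurable functions with values in `[0, ∞]`, as a module on which averaging operators act. -/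
def measFun (X : Type*) [MeasurableSpace X] : Submodule ℝ≥0∞ (X → ℝ≥0∞) where
  carrier := {f | Measurable f}
  add_mem' hf hg := hf.add hg
  zero_mem' := measurable_const
  smul_mem' c _ hf := hf.const_smul c

theorem measurable_esymmStep (k : ℕ) :
    Measurable fun p : ℂ × (Fin (k + 1) → ℂ) => esymmStep k p.1 p.2 := by
  have h : Measurable fun x : Fin (k + 1) → ℂ => shiftOp k x := by
    rw [measurable_pi_iff]
    intro j
    refine Fin.cases ?_ (fun i => ?_) j
    · simp [shiftOp]
    · simpa [shiftOp, Fin.init] using measurable_pi_apply _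
  exact measurable_snd.add (measurable_fst.smul (h.comp measurable_snd))

theorem esymmStep_comm {k : ℕ} (y z : ℂ) (x : Fin (k + 1) → ℂ) :
    esymmStep k y (esymmStep k z x) = esymmStep k z (esymmStep k y x) := by
  simp only [esymmStep, map_add, map_smul, smul_add, smul_comm y z]
  abel

/-- The operator averaging a function over one step with random value of law `μ`, for any s-finite
`μ`, not necessarily of mass one. -/
noncomputable def avgOp (k : ℕ) (μ : Measure ℂ) [SFinite μ] :
    Module.End ℝ≥0∞ (measFun (Fin (k + 1) → ℂ)) where
  toFun f := ⟨fun x => ∫⁻ y, f.1 (esymmStep k y x) ∂μ,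
    (f.2.comp ((measurable_esymmStep k).comp measurable_swap)).lintegral_prod_right'⟩
  map_smul' c f := Subtype.ext (by
    ext x
    exact lintegral_const_mul c (f.2.comp ((measurable_esymmStep k).comp
      (measurable_id.prodMk measurable_const))))
  map_add' f g := Subtype.ext (by
    ext x
    exact lintegral_add_left (f.2.comp ((measurable_esymmStep k).comp
      (measurable_id.prodMk measurable_const))) _)

section avgOp

variable {k : ℕ}

theorem avgOp_apply (μ : Measure ℂ) [SFinite μ] (f : measFun (Fin (k + 1) → ℂ))
    (x : Fin (k + 1) → ℂ) : (avgOp k μ f).1 x = ∫⁻ y, f.1 (esymmStep k y x) ∂μ := rfl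

theorem avgOp_add (μ ν : Measure ℂ) [SFinite μ] [SFinite ν] :
    avgOp k (μ + ν) = avgOp k μ + avgOp k ν := by
  ext f : 1
  refine Subtype.ext ?_
  ext x
  simp only [LinearMap.add_apply, Submodule.coe_add, Pi.add_apply, avgOp_apply]
  exact lintegral_add_measure _ _ _

theorem avgOp_commute (μ ν : Measure ℂ) [SFinite μ] [SFinite ν] :
    Commute (avgOp k μ) (avgOp k ν) := by
  ext f : 1
  refine Subtype.ext ?_
  ext x
  simp only [Module.End.mul_apply, avgOp_apply]
  rw [lintegral_lintegral_swap]
  · simp only [esymmStep_comm]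
  · have hm : Measurable fun a : ℂ × ℂ => (a.2, esymmStep k a.1 x) :=
      measurable_snd.prodMk ((measurable_esymmStep k).comp
        (measurable_fst.prodMk measurable_const))
    exact (f.2.comp ((measurable_esymmStep k).comp hm)).aemeasurable

/-- If `α` is carried by `A`, then the `i`-th power of its operator is bounded through the supremum
over all `i` steps with values in `A`. -/
theorem avgOp_pow_apply_le_of_forall {α : Measure ℂ} [SFinite α] {A : Set ℂ} {w : ℝ≥0∞}
    (hA : ∀ᵐ y ∂α, y ∈ A) (hw : α Set.univ = w) {c : ℝ≥0∞} (f : measFun (Fin (k + 1) → ℂ)) (i : ℕ) :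
    ∀ x : Fin (k + 1) → ℂ,
      (∀ us : List ℂ, us.length = i → (∀ u ∈ us, u ∈ A) →
        f.1 (us.foldl (fun x y => esymmStep k y x) x) ≤ c) →
      ((avgOp k α ^ i) f).1 x ≤ w ^ i * c := by
  induction i with
  | zero => intro x h; simpa using h [] rfl (by simp)
  | succ i ih =>
    intro x h
    rw [pow_succ', Module.End.mul_apply, avgOp_apply]
    calc _ ≤ ∫⁻ _, w ^ i * c ∂α := by
          refine lintegral_mono_ae ?_
          filter_upwards [hA] with y hy
          refine ih _ fun us hus husA => ?_
          simpa using h (y :: us) (by simp [hus]) (by simpa [hy] using husA)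
      _ = _ := by rw [lintegral_const, hw]; ring

theorem avgOp_pow_apply_le {α : Measure ℂ} [SFinite α] {w : ℝ≥0∞} (hw : α Set.univ = w)
    {c : ℝ≥0∞} {f : measFun (Fin (k + 1) → ℂ)} (hf : ∀ x, f.1 x ≤ c) (i : ℕ)
    (x : Fin (k + 1) → ℂ) : ((avgOp k α ^ i) f).1 x ≤ w ^ i * c :=
  avgOp_pow_apply_le_of_forall (A := Set.univ) (by simp) hw f i x fun _ _ _ => hf _

theorem apply_mul_natCast (T : Module.End ℝ≥0∞ (measFun (Fin (k + 1) → ℂ))) (m : ℕ)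
    (f : measFun (Fin (k + 1) → ℂ)) (x : Fin (k + 1) → ℂ) :
    ((T * (m : Module.End ℝ≥0∞ (measFun (Fin (k + 1) → ℂ)))) f).1 x = m * (T f).1 x := by
  rw [Module.End.mul_apply, Module.End.natCast_apply, map_nsmul, Submodule.coe_smul_of_tower,
    Pi.smul_apply, nsmul_eq_mul]

/-- Binomial expansion of the powers of the operator of a sum of three measures. -/
theorem avgOp_add_pow_apply (α β ν : Measure ℂ) [SFinite α] [SFinite β] [SFinite ν] (n : ℕ)
    (h : measFun (Fin (k + 1) → ℂ)) (x : Fin (k + 1) → ℂ) :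
    ((avgOp k (α + β + ν) ^ n) h).1 x = ∑ M ∈ Finset.range (n + 1), (n.choose M : ℝ≥0∞) *
      ∑ j ∈ Finset.range (M + 1), (M.choose j : ℝ≥0∞) *
        ((avgOp k ν ^ (n - M) * (avgOp k α ^ j * avgOp k β ^ (M - j))) h).1 x := by
  have hc : Commute (avgOp k α + avgOp k β) (avgOp k ν) :=
    (avgOp_commute α ν).add_left (avgOp_commute β ν)
  rw [avgOp_add, avgOp_add, hc.add_pow]
  simp only [LinearMap.sum_apply, AddSubmonoidClass.coe_finsetSum, Finset.sum_apply]
  refine Finset.sum_congr rfl fun M _ => ?_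
  rw [apply_mul_natCast, (hc.pow_pow _ _).eq, (avgOp_commute α β).add_pow, Finset.mul_sum]
  simp only [LinearMap.sum_apply, AddSubmonoidClass.coe_finsetSum, Finset.sum_apply]
  congr 1
  refine Finset.sum_congr rfl fun j _ => ?_
  rw [← mul_assoc, apply_mul_natCast]

/-- The window bound for `N` steps passes to longer products of operators, since the additional
factors commute with the others and can be applied last. -/
theorem sum_window_le {α β ν : Measure ℂ} [SFinite α] [SFinite β] [SFinite ν] {w r : ℝ≥0∞}
    (hα : α Set.univ = w) (hβ : β Set.univ = w) (hν : ν Set.univ = r)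
    {h : measFun (Fin (k + 1) → ℂ)} {N : ℕ}
    (hwin : ∀ x, ∑ i ∈ Finset.range (N + 1), ((avgOp k α ^ i * avgOp k β ^ (N - i)) h).1 x ≤
      w ^ N * k) {s M : ℕ} (hs : s + N ≤ M) (m : ℕ) (x : Fin (k + 1) → ℂ) :
    ∑ i ∈ Finset.range (N + 1),
      ((avgOp k ν ^ m * (avgOp k α ^ (s + i) * avgOp k β ^ (M - (s + i)))) h).1 x ≤
      r ^ m * w ^ M * k := by
  set g := ∑ i ∈ Finset.range (N + 1), (avgOp k α ^ i * avgOp k β ^ (N - i)) h with hg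
  have hgle : ∀ x, g.1 x ≤ w ^ N * k := fun x => by
    simpa only [hg, AddSubmonoidClass.coe_finsetSum, Finset.sum_apply] using hwin x
  have e : ∀ i ∈ Finset.range (N + 1),
      ((avgOp k ν ^ m * (avgOp k α ^ (s + i) * avgOp k β ^ (M - (s + i)))) h).1 x =
      ((avgOp k ν ^ m) ((avgOp k α ^ s) ((avgOp k β ^ (M - N - s))
        ((avgOp k α ^ i * avgOp k β ^ (N - i)) h)))).1 x := by
    intro i hi
    have hi' : i ≤ N := Nat.lt_succ_iff.1 (Finset.mem_range.1 hi)
    simp only [← Module.End.mul_apply]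
    rw [show M - (s + i) = (M - N - s) + (N - i) by omega, pow_add, pow_add]
    have hc := ((avgOp_commute (k := k) α β).pow_pow i (M - N - s)).eq
    rw [mul_assoc (avgOp k α ^ s), ← mul_assoc (avgOp k α ^ i), hc]
    simp only [mul_assoc]
  rw [Finset.sum_congr rfl e]
  have e2 : ∑ i ∈ Finset.range (N + 1), ((avgOp k ν ^ m) ((avgOp k α ^ s)
      ((avgOp k β ^ (M - N - s)) ((avgOp k α ^ i * avgOp k β ^ (N - i)) h)))).1 x =
      ((avgOp k ν ^ m) ((avgOp k α ^ s) ((avgOp k β ^ (M - N - s)) g))).1 x := by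
    rw [hg, map_sum, map_sum, map_sum, AddSubmonoidClass.coe_finsetSum, Finset.sum_apply]
  rw [e2]
  refine (avgOp_pow_apply_le hν (fun x => avgOp_pow_apply_le hα
    (fun x => avgOp_pow_apply_le hβ hgle _ x) _ x) m x).trans (le_of_eq ?_)
  rw [show M = s + ((M - N - s) + N) by omega, pow_add w s, pow_add w _ N,
    show s + (M - N - s + N) - N - s = M - N - s by omega]
  ring

/-- The window bound for the operators of `α` and `β` yields a bound for the powers of the operator of
`α + β + ν`, by averaging over the binomial distributions of the numbers of steps of each kind. -/
theorem avgOp_pow_le_of_window {α β ν : Measure ℂ} [SFinite α] [SFinite β] [SFinite ν]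
    {w r : ℝ≥0} (hw : 0 < w) (hwr : 2 * w + r = 1)
    (hα : α Set.univ = w) (hβ : β Set.univ = w) (hν : ν Set.univ = r)
    {h : measFun (Fin (k + 1) → ℂ)} (h1 : ∀ x, h.1 x ≤ 1) {N : ℕ}
    (hwin : ∀ x, ∑ i ∈ Finset.range (N + 1), ((avgOp k α ^ i * avgOp k β ^ (N - i)) h).1 x ≤
      (w : ℝ≥0∞) ^ N * k) (n : ℕ) (x : Fin (k + 1) → ℂ) :
    ((avgOp k (α + β + ν) ^ n) h).1 x ≤
      ENNReal.ofReal (k / (N + 1) + 2 * N / √(2 * w * (n + 1))) := by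
  set a : ℕ → ℕ → ℝ≥0∞ := fun M j =>
    ((avgOp k ν ^ (n - M) * (avgOp k α ^ j * avgOp k β ^ (M - j))) h).1 x with ha
  set q : ℕ → ℝ≥0 := fun M => r ^ (n - M) * w ^ M with hq
  have hale : ∀ M j, j ≤ M → a M j ≤ q M := by
    intro M j hj
    refine (avgOp_pow_apply_le hν (fun x => avgOp_pow_apply_le hα
      (fun x => avgOp_pow_apply_le hβ h1 _ x) _ x) (n - M) x).trans (le_of_eq ?_)
    rw [mul_one, ← pow_add, show j + (M - j) = M by omega, hq]
    push_cast; rfl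
  have hawin : ∀ M s, s + N ≤ M → ∑ i ∈ Finset.range (N + 1), a M (s + i) ≤ k * q M := by
    intro M s hs
    refine (sum_window_le hα hβ hν hwin hs (n - M) x).trans (le_of_eq ?_)
    rw [hq]; push_cast; ring
  have htop : ∀ M j, j ≤ M → a M j ≠ ∞ := fun M j hj =>
    ne_top_of_le_ne_top ENNReal.coe_ne_top (hale M j hj)
  -- extension by zero, so that all windows can be treated alike
  set y : ℕ → ℕ → ℝ := fun M j => if j ≤ M then (a M j).toReal else 0 with hy
  have hy0 : ∀ M j, 0 ≤ y M j := fun M j => by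
    simp only [hy]; split_ifs <;> simp
  have hyq : ∀ M j, y M j ≤ q M := fun M j => by
    simp only [hy]
    split_ifs with hj
    · exact ENNReal.toReal_le_of_le_ofReal (by positivity) (by simpa using hale M j hj)
    · positivity
  have hywin : ∀ M, N ≤ M → ∀ s, ∑ i ∈ Finset.range (N + 1), y M (s + i) ≤ k * q M := by
    intro M hNM
    have hcase : ∀ s, s + N ≤ M → ∑ i ∈ Finset.range (N + 1), y M (s + i) ≤ k * q M := by
      intro s hs
      have e : ∀ i ∈ Finset.range (N + 1), y M (s + i) = (a M (s + i)).toReal := by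
        intro i hi
        have := Finset.mem_range.1 hi
        simp only [hy]; rw [if_pos (by omega)]
      rw [Finset.sum_congr rfl e, ← ENNReal.toReal_sum fun i hi => htop _ _ (by
        have := Finset.mem_range.1 hi; omega)]
      refine ENNReal.toReal_le_of_le_ofReal (by positivity) ?_
      rw [ENNReal.ofReal_mul (by positivity)]
      simpa using hawin M s hs
    intro s
    rcases le_or_gt (s + N) M with hs | hs
    · exact hcase s hs
    · -- a window reaching beyond `M` is contained, up to zeros, in the last window `[M - N, M]`
      refine le_trans ?_ (hcase (M - N) (by omega))
      have e1 : ∀ t, ∑ i ∈ Finset.range (N + 1), y M (t + i) =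
          ∑ j ∈ Finset.Ico t (t + (N + 1)), y M j := fun t => by
        rw [Finset.sum_Ico_eq_sum_range]; simp
      rw [e1, e1, ← Finset.sum_filter_add_sum_filter_not _ (fun j => j ≤ M)]
      have e2 : ∑ j ∈ (Finset.Ico s (s + (N + 1))).filter (fun j => ¬ j ≤ M), y M j = 0 :=
        Finset.sum_eq_zero fun j hj => by
          simp only [hy]; rw [if_neg (Finset.mem_filter.1 hj).2]
      rw [e2, add_zero]
      refine Finset.sum_le_sum_of_subset_of_nonneg (fun j hj => ?_) fun j _ _ => hy0 M j
      simp only [Finset.mem_filter, Finset.mem_Ico] at hj ⊢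
      omega
  have hM : ∀ M, ∑ j ∈ Finset.range (M + 1), (M.choose j : ℝ) * y M j ≤
      2 ^ M * q M * (k / (N + 1) + 2 * N / √(M + 1)) := by
    intro M
    rcases le_or_gt N M with hNM | hNM
    · exact sum_choose_mul_le_of_window M (y M) (hy0 M) (hyq M) (hywin M hNM)
    · -- here the claimed bound exceeds the trivial one
      have h2 : (1 : ℝ) ≤ k / (N + 1) + 2 * N / √(M + 1) := by
        have h3 : (M : ℝ) + 1 ≤ N := by exact_mod_cast hNM
        have h4 : √((M : ℝ) + 1) ≤ M + 1 := by
          rw [Real.sqrt_le_left (by positivity)]; nlinarith [(M.cast_nonneg : (0 : ℝ) ≤ M)]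
        have h5 : 1 ≤ 2 * (N : ℝ) / √(M + 1) := by
          rw [le_div_iff₀ (by positivity)]; linarith
        have : (0 : ℝ) ≤ k / (N + 1) := by positivity
        linarith
      calc _ ≤ ∑ j ∈ Finset.range (M + 1), (M.choose j : ℝ) * q M := by
            gcongr with j; exact hyq M j
        _ = 2 ^ M * q M * 1 := by
            rw [← Finset.sum_mul, mul_one]; congr 1; exact_mod_cast Nat.sum_range_choose M
        _ ≤ _ := by gcongr
  have hexp : ((avgOp k (α + β + ν) ^ n) h).1 x = ENNReal.ofReal
      (∑ M ∈ Finset.range (n + 1), (n.choose M : ℝ) *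
        ∑ j ∈ Finset.range (M + 1), (M.choose j : ℝ) * y M j) := by
    rw [avgOp_add_pow_apply, ENNReal.ofReal_sum_of_nonneg fun M _ => mul_nonneg (by positivity)
      (Finset.sum_nonneg fun j _ => mul_nonneg (by positivity) (hy0 M j))]
    refine Finset.sum_congr rfl fun M _ => ?_
    rw [ENNReal.ofReal_mul (by positivity), ENNReal.ofReal_natCast,
      ENNReal.ofReal_sum_of_nonneg fun j _ => mul_nonneg (by positivity) (hy0 M j)]
    congr 1
    refine Finset.sum_congr rfl fun j hj => ?_
    have hj' : j ≤ M := Nat.lt_succ_iff.1 (Finset.mem_range.1 hj)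
    rw [ENNReal.ofReal_mul (by positivity), ENNReal.ofReal_natCast]
    congr 1
    simp only [hy]
    rw [if_pos hj', ENNReal.ofReal_toReal (htop M j hj')]
  rw [hexp]
  refine ENNReal.ofReal_le_ofReal ?_
  have hwr' : 2 * (w : ℝ) + r = 1 := by exact_mod_cast hwr
  have hw' : (0 : ℝ) < 2 * w := by positivity
  have hone : ∑ M ∈ Finset.range (n + 1), (n.choose M : ℝ) * (2 * w : ℝ) ^ M * (r : ℝ) ^ (n - M)
      = 1 := by
    have := add_pow (2 * w : ℝ) r n
    rw [hwr', one_pow] at this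
    rw [this]; exact Finset.sum_congr rfl fun M _ => by ring
  calc _ ≤ ∑ M ∈ Finset.range (n + 1), (n.choose M : ℝ) *
        (2 ^ M * q M * (k / (N + 1) + 2 * N / √(M + 1))) := by
        gcongr with M; exact hM M
    _ = k / (N + 1) * ∑ M ∈ Finset.range (n + 1),
          (n.choose M : ℝ) * (2 * w : ℝ) ^ M * (r : ℝ) ^ (n - M) +
        2 * N * ∑ M ∈ Finset.range (n + 1),
          (n.choose M : ℝ) * (2 * w : ℝ) ^ M * (r : ℝ) ^ (n - M) * (1 / √(M + 1)) := by
        rw [Finset.mul_sum, Finset.mul_sum, ← Finset.sum_add_distrib]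
        refine Finset.sum_congr rfl fun M _ => ?_
        simp only [hq]; push_cast; ring
    _ ≤ k / (N + 1) * 1 + 2 * N * (1 / √(2 * w * (n + 1))) := by
        rw [hone]
        gcongr
        exact sum_binomial_inv_sqrt_le hw' r.2 hwr'
    _ = _ := by ring

end avgOp

/-! ### Two separated concentrated parts of a nondegenerate law -/

/-- Pigeonhole over a grid of squares of side `η / 2`, of which at most `(6 R / η) ^ 2` meet the
square `[-R, R] ^ 2`. -/
theorem exists_heavy_closedBall {μ : Measure ℂ} [IsFiniteMeasure μ] {X : Set ℂ} {R : ℝ}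
    (hR : 1 ≤ R) (hX : X ⊆ Metric.closedBall 0 R) (hpos : 0 < μ.real X) {η : ℝ} (hη : 0 < η)
    (hη1 : η ≤ 1) :
    ∃ a ∈ X, μ.real X * η ^ 2 / (36 * R ^ 2) ≤ μ.real (X ∩ Metric.closedBall a η) := by
  by_contra! hcon
  set S : Finset ℤ := Finset.Icc ⌊-R / (η / 2)⌋ ⌊R / (η / 2)⌋ with hS
  set cell : ℤ × ℤ → Set ℂ := fun p => {z ∈ X | ⌊z.re / (η / 2)⌋ = p.1 ∧ ⌊z.im / (η / 2)⌋ = p.2}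
    with hcell
  have hη2 : 0 < η / 2 := by positivity
  have hmem : ∀ {u : ℝ}, |u| ≤ R → ⌊u / (η / 2)⌋ ∈ S := fun {u} hu => by
    rw [hS, Finset.mem_Icc]
    constructor <;> refine Int.floor_mono ?_ <;> gcongr
    · exact (abs_le.1 hu).1
    · exact (abs_le.1 hu).2
  have hcover : X ⊆ ⋃ p ∈ S ×ˢ S, cell p := by
    intro z hz
    have hzR : ‖z‖ ≤ R := by simpa using hX hz
    simp only [Set.mem_iUnion]
    exact ⟨(⌊z.re / (η / 2)⌋, ⌊z.im / (η / 2)⌋), Finset.mem_product.2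
      ⟨hmem ((Complex.abs_re_le_norm z).trans hzR), hmem ((Complex.abs_im_le_norm z).trans hzR)⟩,
      hz, rfl, rfl⟩
  have hclose : ∀ {u v : ℝ}, ⌊u / (η / 2)⌋ = ⌊v / (η / 2)⌋ → |u - v| ≤ η / 2 := fun {u v} h => by
    have := Int.abs_sub_lt_one_of_floor_eq_floor h
    rw [← sub_div, abs_div, abs_of_pos hη2, div_lt_one hη2] at this
    exact this.le
  have hlt : ∀ p, μ.real (cell p) < μ.real X * η ^ 2 / (36 * R ^ 2) := by
    intro p
    rcases (cell p).eq_empty_or_nonempty with h | ⟨a, ha⟩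
    · rw [h, measureReal_empty]; positivity
    · refine lt_of_le_of_lt (measureReal_mono ?_) (hcon a ha.1)
      intro z hz
      refine ⟨hz.1, ?_⟩
      rw [mem_closedBall_iff_norm]
      refine (Complex.norm_le_abs_re_add_abs_im _).trans ?_
      have h1 := hclose (hz.2.1.trans ha.2.1.symm)
      have h2 := hclose (hz.2.2.trans ha.2.2.symm)
      rw [Complex.sub_re, Complex.sub_im]
      linarith
  have h0 : ⌊(0 : ℝ) / (η / 2)⌋ ∈ S := hmem (by rw [abs_zero]; linarith)
  have hne : (S ×ˢ S).Nonempty := ⟨(_, _), Finset.mem_product.2 ⟨h0, h0⟩⟩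
  have hcard : (S.card : ℝ) ≤ 6 * R / η := by
    rw [hS, Int.card_Icc]
    have h1 : ⌊-R / (η / 2)⌋ ≤ ⌊R / (η / 2)⌋ := by
      refine Int.floor_mono ?_; gcongr; linarith
    have h2 := Int.floor_le (R / (η / 2))
    have h3 := Int.lt_floor_add_one (-R / (η / 2))
    have h4 : (((⌊R / (η / 2)⌋ + 1 - ⌊-R / (η / 2)⌋).toNat : ℤ) : ℝ) =
        ⌊R / (η / 2)⌋ + 1 - ⌊-R / (η / 2)⌋ := by
      rw [Int.toNat_of_nonneg (by omega)]; push_cast; rfl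
    rw [Int.cast_natCast] at h4
    rw [h4]
    have h5 : 1 ≤ R / η := by rw [le_div_iff₀ hη]; linarith
    have h6 : R / (η / 2) = 2 * (R / η) := by field_simp
    have h7 : -R / (η / 2) = -(2 * (R / η)) := by field_simp
    have h8 : 6 * R / η = 6 * (R / η) := by ring
    rw [h6] at h2
    rw [h7] at h3
    rw [h6, h7, h8]
    linarith
  have : μ.real X < μ.real X := by
    calc μ.real X ≤ μ.real (⋃ p ∈ S ×ˢ S, cell p) :=
        measureReal_mono hcover (measure_ne_top _ _)
      _ ≤ ∑ p ∈ S ×ˢ S, μ.real (cell p) := measureReal_biUnion_finset_le _ _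
      _ < ∑ p ∈ S ×ˢ S, μ.real X * η ^ 2 / (36 * R ^ 2) :=
        Finset.sum_lt_sum_of_nonempty hne fun p _ => hlt p
      _ = (S.card : ℝ) ^ 2 * (μ.real X * η ^ 2 / (36 * R ^ 2)) := by
        rw [Finset.sum_const, Finset.card_product, nsmul_eq_mul]; push_cast; ring
      _ ≤ (6 * R / η) ^ 2 * (μ.real X * η ^ 2 / (36 * R ^ 2)) := by gcongr
      _ = μ.real X := by field_simp; ring
  exact lt_irrefl _ this

theorem exists_ne_mem_support {μ : Measure ℂ} [IsProbabilityMeasure μ]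
    (h : ¬ ∃ c : ℂ, ∀ᵐ y ∂μ, y = c) : ∃ x ∈ μ.support, ∃ y ∈ μ.support, x ≠ y := by
  by_contra! hcon
  have hs : ∀ᵐ y ∂μ, y ∈ μ.support := Measure.support_mem_ae
  obtain ⟨c, hc⟩ := hs.exists
  exact h ⟨c, hs.mono fun y hy => hcon y hy c hc⟩

/-- A law that is not a point mass splits, at every scale `η`, into two parts of equal mass `c η ^ 2`
carried by balls of radius `η` with separated centres, and a remainder. -/
theorem exists_measure_decomposition {μ : Measure ℂ} [IsProbabilityMeasure μ]
    (h : ¬ ∃ c : ℂ, ∀ᵐ y ∂μ, y = c) :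
    ∃ R δ c : ℝ, 1 ≤ R ∧ 0 < δ ∧ 0 < c ∧ ∀ η : ℝ, 0 < η → η ≤ 1 →
      ∃ (a b : ℂ) (α β ν : Measure ℂ) (w r : ℝ≥0), IsFiniteMeasure α ∧ IsFiniteMeasure β ∧
        IsFiniteMeasure ν ∧ ‖a‖ ≤ R ∧ ‖b‖ ≤ R ∧ δ ≤ ‖a - b‖ ∧ μ = α + β + ν ∧
        α Set.univ = w ∧ β Set.univ = w ∧ ν Set.univ = r ∧ 2 * w + r = 1 ∧
        (w : ℝ) = c * η ^ 2 ∧ (∀ᵐ y ∂α, ‖y - a‖ ≤ η) ∧ (∀ᵐ y ∂β, ‖y - b‖ ≤ η) := by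
  obtain ⟨x, hx, y, hy, hxy⟩ := exists_ne_mem_support h
  set D : ℝ := ‖x - y‖ / 4 with hD
  have hDpos : 0 < D := by have := norm_pos_iff.2 (sub_ne_zero.2 hxy); positivity
  set R : ℝ := 1 + ‖x‖ + ‖y‖ + D with hRdef
  have hR : 1 ≤ R := by have := norm_nonneg x; have := norm_nonneg y; linarith
  have hball : ∀ z ∈ μ.support, 0 < μ.real (Metric.closedBall z D) := fun z hz =>
    ENNReal.toReal_pos ((Measure.mem_support_iff_forall z).1 hz _
      (Metric.closedBall_mem_nhds z hDpos)).ne' (measure_ne_top _ _)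
  have hnear : ∀ {z u : ℂ}, u ∈ Metric.closedBall z D → ‖u‖ ≤ ‖z‖ + D := fun {z u} hu => by
    rw [mem_closedBall_iff_norm] at hu
    calc ‖u‖ = ‖z + (u - z)‖ := by ring_nf
      _ ≤ _ := (norm_add_le _ _).trans (by linarith)
  have hXR : Metric.closedBall x D ⊆ Metric.closedBall 0 R := fun u hu => by
    have := hnear hu; have := norm_nonneg y; simp; linarith
  have hYR : Metric.closedBall y D ⊆ Metric.closedBall 0 R := fun u hu => by
    have := hnear hu; have := norm_nonneg x; simp; linarith
  set m := min (μ.real (Metric.closedBall x D)) (μ.real (Metric.closedBall y D)) with hm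
  have hmpos : 0 < m := lt_min (hball x hx) (hball y hy)
  have hsep : ∀ u ∈ Metric.closedBall x D, ∀ v ∈ Metric.closedBall y D, 2 * D ≤ ‖u - v‖ := by
    intro u hu v hv
    rw [mem_closedBall_iff_norm'] at hu
    rw [mem_closedBall_iff_norm] at hv
    have h4 : ‖x - y‖ = 4 * D := by rw [hD]; ring
    have : ‖x - y‖ ≤ ‖x - u‖ + ‖u - v‖ + ‖v - y‖ := by
      calc ‖x - y‖ = ‖(x - u) + (u - v) + (v - y)‖ := by ring_nf
        _ ≤ _ := norm_add₃_le
    linarith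
  refine ⟨R, 2 * D, m / (36 * R ^ 2), hR, by positivity, by positivity, fun η hη hη1 => ?_⟩
  obtain ⟨a, ha, hA⟩ := exists_heavy_closedBall hR hXR (hball x hx) hη hη1
  obtain ⟨b, hb, hB⟩ := exists_heavy_closedBall hR hYR (hball y hy) hη hη1
  set A := Metric.closedBall x D ∩ Metric.closedBall a η with hAdef
  set B := Metric.closedBall y D ∩ Metric.closedBall b η with hBdef
  have hAm : MeasurableSet A := measurableSet_closedBall.inter measurableSet_closedBall
  have hBm : MeasurableSet B := measurableSet_closedBall.inter measurableSet_closedBall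
  have hAB : Disjoint A B := Set.disjoint_left.2 fun u hu hv => by
    have := hsep u hu.1 u hv.1
    simp at this; linarith
  set w : ℝ≥0 := ⟨m / (36 * R ^ 2) * η ^ 2, by positivity⟩ with hw
  have hwr : (w : ℝ) = m / (36 * R ^ 2) * η ^ 2 := rfl
  have hwpos : 0 < w := by rw [← NNReal.coe_pos, hwr]; positivity
  have hwA : (w : ℝ≥0∞) ≤ μ A := by
    rw [← ENNReal.ofReal_coe_nnreal, ← ofReal_measureReal]
    refine ENNReal.ofReal_le_ofReal (le_trans ?_ hA)
    rw [hwr, div_mul_eq_mul_div]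
    gcongr; exact min_le_left _ _
  have hwB : (w : ℝ≥0∞) ≤ μ B := by
    rw [← ENNReal.ofReal_coe_nnreal, ← ofReal_measureReal]
    refine ENNReal.ofReal_le_ofReal (le_trans ?_ hB)
    rw [hwr, div_mul_eq_mul_div]
    gcongr; exact min_le_right _ _
  have hmass : ∀ s : Set ℂ, (w : ℝ≥0∞) ≤ μ s →
      (((w : ℝ≥0∞) / μ s) • μ.restrict s) Set.univ = w := fun s hs => by
    rw [Measure.smul_apply, Measure.restrict_apply_univ, smul_eq_mul]
    exact ENNReal.div_mul_cancel (lt_of_lt_of_le (by exact_mod_cast hwpos) hs).ne'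
      (measure_ne_top _ _)
  have hle : ∀ s : Set ℂ, (w : ℝ≥0∞) ≤ μ s →
      ((w : ℝ≥0∞) / μ s) • μ.restrict s ≤ μ.restrict s := fun s hs => by
    refine Measure.le_iff.2 fun t _ => ?_
    rw [Measure.smul_apply, smul_eq_mul]
    exact mul_le_of_le_one_left' (ENNReal.div_le_of_le_mul (by simpa using hs))
  set α : Measure ℂ := ((w : ℝ≥0∞) / μ A) • μ.restrict A with hα
  set β : Measure ℂ := ((w : ℝ≥0∞) / μ B) • μ.restrict B with hβ
  have hαw : α Set.univ = w := hmass A hwA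
  have hβw : β Set.univ = w := hmass B hwB
  have : IsFiniteMeasure α := ⟨by rw [hαw]; exact ENNReal.coe_lt_top⟩
  have : IsFiniteMeasure β := ⟨by rw [hβw]; exact ENNReal.coe_lt_top⟩
  have hαβ : α + β ≤ μ := by
    calc α + β ≤ μ.restrict A + μ.restrict B := add_le_add (hle A hwA) (hle B hwB)
      _ = μ.restrict (A ∪ B) := (Measure.restrict_union hAB hBm).symm
      _ ≤ μ := Measure.restrict_le_self
  have hsum : μ = α + β + (μ - (α + β)) := by
    rw [add_comm, Measure.sub_add_cancel_of_le hαβ]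
  have hν : IsFiniteMeasure (μ - (α + β)) := inferInstance
  refine ⟨a, b, α, β, μ - (α + β), w, ((μ - (α + β)) Set.univ).toNNReal, inferInstance,
    inferInstance, hν, by simpa using hXR ha, by simpa using hYR hb, hsep a ha b hb, hsum, hαw, hβw,
    (ENNReal.coe_toNNReal (measure_ne_top _ _)).symm, ?_, hwr, ?_, ?_⟩
  · have h1 : μ Set.univ = 1 := measure_univ
    rw [hsum, Measure.add_apply, Measure.add_apply, hαw, hβw, ← two_mul] at h1
    rw [← ENNReal.coe_inj]
    push_cast
    rw [ENNReal.coe_toNNReal (measure_ne_top _ _), h1]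
  · refine Measure.ae_smul_measure ?_ _
    filter_upwards [ae_restrict_mem hAm] with u hu
    exact mem_closedBall_iff_norm.1 hu.2
  · refine Measure.ae_smul_measure ?_ _
    filter_upwards [ae_restrict_mem hBm] with u hu
    exact mem_closedBall_iff_norm.1 hu.2

/-! ### Small-ball bound for a fixed number of variables -/

/-- The values `(e_0, …, e_k)` of the elementary symmetric polynomials at `y_0, …, y_{n-1}`. -/
noncomputable def esymmVec (k n : ℕ) (y : ℕ → ℂ) : Fin (k + 1) → ℂ :=
  fun j => ∑ S ∈ (Finset.range n).powersetCard j, ∏ i ∈ S, y i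

theorem esymmVec_succ (k n : ℕ) (y : ℕ → ℂ) :
    esymmVec k (n + 1) y = esymmStep k (y n) (esymmVec k n y) := by
  ext j
  refine Fin.cases ?_ (fun i => ?_) j
  · simp [esymmVec, esymmStep, shiftOp]
  · simp only [esymmVec, esymmStep, shiftOp, LinearMap.coe_mk, AddHom.coe_mk, Pi.add_apply,
      Pi.smul_apply, Fin.cons_succ, Fin.init, smul_eq_mul, Fin.val_succ, Fin.val_castSucc]
    have hn : n ∉ Finset.range n := by simp
    rw [Finset.range_add_one, Finset.powersetCard_succ_insert hn, Finset.sum_union, Finset.mul_sum,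
      Finset.sum_image]
    · congr 1
      refine Finset.sum_congr rfl fun S hS => ?_
      rw [Finset.prod_insert fun h => hn ((Finset.mem_powersetCard.1 hS).1 h)]
    · intro S hS T hT hST
      have hS' : n ∉ S := fun h => hn ((Finset.mem_powersetCard.1 hS).1 h)
      have hT' : n ∉ T := fun h => hn ((Finset.mem_powersetCard.1 hT).1 h)
      rw [← Finset.erase_insert hS', ← Finset.erase_insert hT', hST]
    · rw [Finset.disjoint_left]
      intro S hS hS'
      obtain ⟨T, _, rfl⟩ := Finset.mem_image.1 hS'
      exact hn ((Finset.mem_powersetCard.1 hS).1 (Finset.mem_insert_self _ _))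

theorem measurable_esymmVec (k n : ℕ) {Ω : Type*} [MeasurableSpace Ω] {Y : ℕ → Ω → ℂ}
    (hY : ∀ i, Measurable (Y i)) : Measurable fun ω => esymmVec k n fun i => Y i ω := by
  rw [measurable_pi_iff]
  intro j
  simp only [esymmVec]
  fun_prop

/-- The vector of elementary symmetric polynomials of i.i.d. variables is a Markov chain, with
transition operator `avgOp k μ`. -/
theorem lintegral_esymmVec {Ω : Type*} [MeasurableSpace Ω] {P : Measure Ω}
    [IsProbabilityMeasure P] {Y : ℕ → Ω → ℂ} (hY : ∀ i, Measurable (Y i)) (hindep : iIndepFun Y P)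
    {μ : Measure ℂ} [SFinite μ] (hμ : ∀ i, P.map (Y i) = μ) (k n : ℕ) :
    ∀ f : measFun (Fin (k + 1) → ℂ), ∫⁻ ω, f.1 (esymmVec k n fun i => Y i ω) ∂P =
      ((avgOp k μ ^ n) f).1 (esymmVec k 0 0) := by
  induction n with
  | zero =>
    intro f
    have h0 : ∀ y, esymmVec k 0 y = esymmVec k 0 0 := fun y => by
      ext j
      refine Finset.sum_congr rfl fun S hS => Finset.prod_congr rfl fun i hi => ?_
      exact absurd ((Finset.mem_powersetCard.1 hS).1 hi) (by simp)
    simp [h0]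
  | succ n ih =>
    intro f
    rw [pow_succ, Module.End.mul_apply, ← ih]
    have hV := measurable_esymmVec k n hY
    have hind : IndepFun (fun ω => esymmVec k n fun i => Y i ω) (Y n) P := by
      have h := hindep.indepFun_finset (Finset.range n) {n} (by simp) hY
      have h1 : Measurable fun z : Finset.range n → ℂ =>
          esymmVec k n fun i => if h : i ∈ Finset.range n then z ⟨i, h⟩ else 0 := by
        refine measurable_esymmVec k n (Y := fun i (z : Finset.range n → ℂ) =>
          if h : i ∈ Finset.range n then z ⟨i, h⟩ else 0) fun i => ?_
        split_ifs <;> fun_prop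
      have h2 : Measurable fun z : ({n} : Finset ℕ) → ℂ => z ⟨n, by simp⟩ :=
        measurable_pi_apply _
      convert h.comp h1 h2 using 1
      · ext ω j
        simp only [Function.comp, esymmVec]
        refine Finset.sum_congr rfl fun S hS => Finset.prod_congr rfl fun i hi => ?_
        rw [dif_pos ((Finset.mem_powersetCard.1 hS).1 hi)]
      · rfl
    have hlaw := (indepFun_iff_map_prod_eq_prod_map_map hV.aemeasurable (hY n).aemeasurable).1 hind
    have hF : Measurable fun p : (Fin (k + 1) → ℂ) × ℂ => f.1 (esymmStep k p.2 p.1) :=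
      f.2.comp ((measurable_esymmStep k).comp measurable_swap)
    calc _ = ∫⁻ ω, (fun p : (Fin (k + 1) → ℂ) × ℂ => f.1 (esymmStep k p.2 p.1))
          (esymmVec k n fun i => Y i ω, Y n ω) ∂P := by simp only [esymmVec_succ]
      _ = ∫⁻ p, f.1 (esymmStep k p.2 p.1) ∂(P.map fun ω => (esymmVec k n fun i => Y i ω, Y n ω)) :=
        (lintegral_map hF (hV.prodMk (hY n))).symm
      _ = ∫⁻ x, (avgOp k μ f).1 x ∂(P.map fun ω => esymmVec k n fun i => Y i ω) := by
        rw [hlaw, hμ, lintegral_prod _ hF.aemeasurable]; rfl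
      _ = _ := lintegral_map (avgOp k μ f).2 hV

/-- The indicator function of the vectors with `e_0 = 1` and `‖e_k‖ ≤ t`. The condition on `e_0`,
which every step preserves, makes the window bound hold at all vectors. -/
noncomputable def smallBall (k : ℕ) (t : ℝ) : measFun (Fin (k + 1) → ℂ) :=
  ⟨Set.indicator {x | x 0 = 1 ∧ ‖x (Fin.last k)‖ ≤ t} 1, measurable_one.indicator <| by
    refine MeasurableSet.inter ?_ ?_
    · exact measurableSet_eq_fun (measurable_pi_apply _) measurable_const
    · exact measurableSet_le (measurable_pi_apply _).norm measurable_const⟩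

theorem foldl_esymmStep_zero {k : ℕ} (us : List ℂ) :
    ∀ x : Fin (k + 1) → ℂ, us.foldl (fun x y => esymmStep k y x) x 0 = x 0 := by
  induction us with
  | nil => intro x; rfl
  | cons y us ih => intro x; rw [List.foldl_cons, ih]; simp [esymmStep, shiftOp]

open scoped Classical in
/-- The operator form of `card_small_le`. -/
theorem sum_avgOp_smallBall_le {k N : ℕ} (hkN : k ≤ N) {a b : ℂ} {R δ η t : ℝ} (hR : 1 ≤ R)
    (ha : ‖a‖ ≤ R) (hb : ‖b‖ ≤ R) (hδ : 0 < δ) (hab : δ ≤ ‖a - b‖) (hη0 : 0 ≤ η) (hη : η ≤ 1)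
    (ht : t ≤ η)
    (hsmall : (2 * R) ^ N * ((k + 1) * (N : ℝ) ^ k * ((1 + (2 + R) ^ N * N) * η)) < δ ^ N)
    {α β : Measure ℂ} [SFinite α] [SFinite β] {w : ℝ≥0∞} (hα : α Set.univ = w)
    (hβ : β Set.univ = w) (hαa : ∀ᵐ y ∂α, ‖y - a‖ ≤ η) (hβb : ∀ᵐ y ∂β, ‖y - b‖ ≤ η)
    (x : Fin (k + 1) → ℂ) :
    ∑ i ∈ Finset.range (N + 1), ((avgOp k α ^ i * avgOp k β ^ (N - i)) (smallBall k t)).1 x ≤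
      w ^ N * k := by
  set I := (Finset.range (N + 1)).filter fun i => ∃ us vs : List ℂ, us.length = i ∧
    vs.length = N - i ∧ (∀ u ∈ us, ‖u - a‖ ≤ η) ∧ (∀ v ∈ vs, ‖v - b‖ ≤ η) ∧
    (smallBall k t).1 (vs.foldl (fun x y => esymmStep k y x)
      (us.foldl (fun x y => esymmStep k y x) x)) ≠ 0 with hI
  have hcard : I.card ≤ k := by
    by_cases hx : x 0 = 1
    · refine card_small_le hkN hR ha hb hδ hab hη0 hη ht hsmall hx (Finset.filter_subset _ _)
        fun i hi => ?_
      obtain ⟨us, vs, h1, h2, h3, h4, h5⟩ := (Finset.mem_filter.1 hi).2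
      exact ⟨us, vs, h1, h2, h3, h4, (Set.mem_of_indicator_ne_zero h5).2⟩
    · rw [Finset.card_eq_zero.2]
      · exact zero_le
      · refine Finset.filter_eq_empty_iff.2 fun i _ ⟨us, vs, _, _, _, _, h5⟩ => hx ?_
        have := (Set.mem_of_indicator_ne_zero h5).1
        rwa [foldl_esymmStep_zero, foldl_esymmStep_zero] at this
  have hterm : ∀ i ∈ Finset.range (N + 1),
      ((avgOp k α ^ i * avgOp k β ^ (N - i)) (smallBall k t)).1 x ≤
        if i ∈ I then w ^ N else 0 := by
    intro i hi
    have hiN : i ≤ N := Nat.lt_succ_iff.1 (Finset.mem_range.1 hi)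
    have hc : (if i ∈ I then w ^ N else 0) =
        w ^ i * (w ^ (N - i) * (if i ∈ I then 1 else 0)) := by
      split_ifs
      · rw [mul_one, ← pow_add]; congr 1; omega
      · simp
    rw [hc, Module.End.mul_apply]
    refine avgOp_pow_apply_le_of_forall (A := {y | ‖y - a‖ ≤ η}) hαa hα _ i x
      fun us hus husa => ?_
    refine avgOp_pow_apply_le_of_forall (A := {y | ‖y - b‖ ≤ η}) hβb hβ _ (N - i) _
      fun vs hvs hvsb => ?_
    split_ifs with hiI
    · exact Set.indicator_le_self' (fun _ _ => zero_le) _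
    · by_contra hne
      exact hiI (Finset.mem_filter.2 ⟨hi, us, vs, hus, hvs, husa, hvsb, fun h => hne h.le⟩)
  calc _ ≤ ∑ i ∈ Finset.range (N + 1), if i ∈ I then w ^ N else 0 := Finset.sum_le_sum hterm
    _ = I.card * w ^ N := by
      rw [← Finset.sum_filter, Finset.sum_const, nsmul_eq_mul]
      congr 3
      ext i
      simp only [Finset.mem_filter, and_iff_right_iff_imp]
      exact fun h => (Finset.mem_filter.1 h).1
    _ ≤ k * w ^ N := by gcongr
    _ = _ := mul_comm _ _

theorem measure_small_le {Ω : Type*} [MeasurableSpace Ω] {P : Measure Ω}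
    [IsProbabilityMeasure P] {Y : ℕ → Ω → ℂ} (hY : ∀ i, Measurable (Y i)) (hindep : iIndepFun Y P)
    {μ : Measure ℂ} (hμ : ∀ i, P.map (Y i) = μ) {k N : ℕ} (hkN : k ≤ N) {a b : ℂ}
    {R δ η t : ℝ} (hR : 1 ≤ R) (ha : ‖a‖ ≤ R) (hb : ‖b‖ ≤ R) (hδ : 0 < δ) (hab : δ ≤ ‖a - b‖)
    (hη0 : 0 ≤ η) (hη : η ≤ 1) (ht : t ≤ η)
    (hsmall : (2 * R) ^ N * ((k + 1) * (N : ℝ) ^ k * ((1 + (2 + R) ^ N * N) * η)) < δ ^ N)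
    {α β ν : Measure ℂ} [SFinite α] [SFinite β] [SFinite ν] (hsum : μ = α + β + ν) {w r : ℝ≥0}
    (hw : 0 < w) (hwr : 2 * w + r = 1) (hα : α Set.univ = w) (hβ : β Set.univ = w)
    (hν : ν Set.univ = r) (hαa : ∀ᵐ y ∂α, ‖y - a‖ ≤ η) (hβb : ∀ᵐ y ∂β, ‖y - b‖ ≤ η) (n : ℕ) :
    P {ω | ‖∑ S ∈ (Finset.range n).powersetCard k, ∏ i ∈ S, Y i ω‖ ≤ t} ≤
      ENNReal.ofReal (k / (N + 1) + 2 * N / √(2 * w * (n + 1))) := by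
  subst hsum
  have hmeas : MeasurableSet {ω | ‖∑ S ∈ (Finset.range n).powersetCard k, ∏ i ∈ S, Y i ω‖ ≤ t} :=
    measurableSet_le (by fun_prop) measurable_const
  have h1 := lintegral_esymmVec hY hindep hμ k n (smallBall k t)
  have h2 : ∀ ω, (smallBall k t).1 (esymmVec k n fun i => Y i ω) =
      Set.indicator {ω | ‖∑ S ∈ (Finset.range n).powersetCard k, ∏ i ∈ S, Y i ω‖ ≤ t} 1 ω := by
    intro ω
    simp [smallBall, Set.indicator, esymmVec]
  simp only [h2] at h1
  rw [lintegral_indicator_one hmeas] at h1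
  rw [h1]
  exact avgOp_pow_le_of_window hw hwr hα hβ hν
    (fun x => Set.indicator_le_self' (fun _ _ => zero_le) _)
    (sum_avgOp_smallBall_le hkN hR ha hb hδ hab hη0 hη ht hsmall hα hβ hαa hβb) n _

/-! ### Choice of the scales -/

/-- With `l = log n`, the bound `k ≤ l / (5 log l)` gives `k ^ k ≤ n ^ (1/5)` and `C ^ k ≤ n ^ (1/100)`,
which leaves room below `n ^ (1/3)`. -/
theorem two_mul_pow_mul_self_pow_mul_exp_lt_one {k : ℕ} {C l : ℝ} (hC : 1 ≤ C) (hk : 1 ≤ k)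
    (hkl : (k : ℝ) ≤ l / (5 * Real.log l)) (h1 : 20 * Real.log C ≤ Real.log l)
    (h2 : 1 ≤ Real.log l) (h3 : 100 ≤ l) :
    2 * C ^ k * (k : ℝ) ^ k * Real.exp (-l / 3) < 1 := by
  have hk0 : (0 : ℝ) < k := by exact_mod_cast hk
  have hmul : (k : ℝ) * (5 * Real.log l) ≤ l := (le_div_iff₀ (by positivity)).1 hkl
  have hkle : (k : ℝ) ≤ l := by nlinarith
  have hlogk : Real.log k ≤ Real.log l := Real.log_le_log hk0 hkle
  have hCk : C ^ k ≤ Real.exp (l / 100) := by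
    rw [← Real.log_le_iff_le_exp (by positivity), Real.log_pow]
    nlinarith
  have hkk : (k : ℝ) ^ k ≤ Real.exp (l / 5) := by
    rw [← Real.log_le_iff_le_exp (by positivity), Real.log_pow]
    nlinarith
  have h2e : (2 : ℝ) ≤ Real.exp (l / 100) := by
    have := Real.add_one_le_exp (l / 100)
    linarith
  calc _ ≤ Real.exp (l / 100) * Real.exp (l / 100) * Real.exp (l / 5) * Real.exp (-l / 3) := by
        gcongr
    _ = Real.exp (l / 100 + l / 100 + l / 5 + -l / 3) := by simp only [Real.exp_add]
    _ < 1 := by rw [Real.exp_lt_one_iff]; linarith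

/-- The smallness condition of `card_small_le` for `N = A k`, all exponential factors being collected
in a constant `C`. -/
theorem smallness_of_lt_one {A k : ℕ} (hA : 1 ≤ A) (hk : 1 ≤ k) {R δ η C : ℝ} (hR : 1 ≤ R)
    (hδ : 0 < δ) (hη : 0 ≤ η) (hC : (4 * R * (2 + R) / δ) ^ A * 2 * A ≤ C)
    (h : 2 * C ^ k * (k : ℝ) ^ k * η < 1) :
    (2 * R) ^ (A * k) * ((k + 1) * ((A * k : ℕ) : ℝ) ^ k *
      ((1 + (2 + R) ^ (A * k) * (A * k : ℕ)) * η)) < δ ^ (A * k) := by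
  set N := A * k with hN
  have h1 : (N : ℝ) ≤ 2 ^ N := by exact_mod_cast Nat.lt_two_pow_self.le
  have h2 : ((k : ℝ) + 1) ≤ 2 ^ k := by exact_mod_cast Nat.lt_two_pow_self (n := k)
  have h3 : 1 + (2 + R) ^ N * N ≤ 2 * ((2 + R) ^ N * 2 ^ N) := by
    have h4 : 1 ≤ (2 + R) ^ N * 2 ^ N := by
      rw [← mul_pow]; exact one_le_pow₀ (by linarith)
    have h5 : (2 + R) ^ N * N ≤ (2 + R) ^ N * 2 ^ N := by gcongr
    linarith
  have hδN : 0 < δ ^ N := by positivity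
  calc _ ≤ (2 * R) ^ N * (2 ^ k * (N : ℝ) ^ k * ((2 * ((2 + R) ^ N * 2 ^ N)) * η)) := by gcongr
    _ = δ ^ N * (2 * ((4 * R * (2 + R) / δ) ^ A * 2 * A) ^ k * (k : ℝ) ^ k * η) := by
      have e : (4 * R * (2 + R) / δ) ^ A * 2 * A = (2 * R * (2 + R) * 2 / δ) ^ A * (2 * A) := by
        ring
      rw [e, mul_pow ((2 * R * (2 + R) * 2 / δ) ^ A) (2 * (A : ℝ)) k, ← pow_mul, ← hN, div_pow,
        mul_pow _ 2 N, mul_pow _ (2 + R) N, mul_pow (2 : ℝ) (A : ℝ) k]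
      have e2 : (N : ℝ) ^ k = (A : ℝ) ^ k * (k : ℝ) ^ k := by
        rw [hN, ← mul_pow]; push_cast; rfl
      rw [e2]
      field_simp
    _ ≤ δ ^ N * (2 * C ^ k * (k : ℝ) ^ k * η) := by gcongr
    _ < δ ^ N * 1 := by gcongr
    _ = _ := mul_one _

theorem eventually_measure_small_le {Ω : Type*} [MeasurableSpace Ω] {P : Measure Ω}
    [IsProbabilityMeasure P] {Y : ℕ → Ω → ℂ} (hY : ∀ i, Measurable (Y i)) (hindep : iIndepFun Y P)
    {μ : Measure ℂ} [IsProbabilityMeasure μ] (hμ : ∀ i, P.map (Y i) = μ)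
    (hnondeg : ¬ ∃ c : ℂ, ∀ᵐ y ∂μ, y = c) {k : ℕ → ℕ}
    (hk : ∀ᶠ n : ℕ in atTop,
      1 ≤ k n ∧ (k n : ℝ) ≤ Real.log (n : ℝ) / (5 * Real.log (Real.log (n : ℝ))))
    {ε : ℝ} (hε : 0 < ε) {A : ℕ} (hA : 1 ≤ A) :
    ∀ᶠ n : ℕ in atTop,
      P {ω | ‖∑ S ∈ (Finset.range n).powersetCard (k n), ∏ i ∈ S, Y i ω‖
        ≤ Real.exp (-ε * (n : ℝ))} ≤ ENNReal.ofReal (2 / A) := by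
  obtain ⟨R, δ, c, hR, hδ, hc, hdec⟩ := exists_measure_decomposition hnondeg
  have hA0 : (0 : ℝ) < A := by exact_mod_cast hA
  set C : ℝ := max 1 ((4 * R * (2 + R) / δ) ^ A * 2 * A) with hC
  have hlog : Tendsto (fun n : ℕ => Real.log n) atTop atTop :=
    Real.tendsto_log_atTop.comp tendsto_natCast_atTop_atTop
  have hloglog : Tendsto (fun n : ℕ => Real.log (Real.log n)) atTop atTop :=
    Real.tendsto_log_atTop.comp hlog
  have hexp : ∀ᶠ n : ℕ in atTop, 2 * A ^ 2 * Real.log n ≤ √c * Real.exp (1 / 6 * Real.log n) := by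
    have h := (isLittleO_pow_exp_pos_mul_atTop 1 (show (0 : ℝ) < 1 / 6 by norm_num)).bound
      (show 0 < √c / (2 * A ^ 2) by positivity)
    filter_upwards [hlog.eventually h, hlog.eventually_ge_atTop 0] with n hn h0
    rw [pow_one, Real.norm_of_nonneg h0, Real.norm_of_nonneg (Real.exp_pos _).le,
      div_mul_eq_mul_div, le_div_iff₀ (by positivity)] at hn
    linarith
  have hlin : ∀ᶠ n : ℕ in atTop, Real.log n ≤ 3 * ε * n := by
    have h := Real.isLittleO_log_id_atTop.bound (show 0 < 3 * ε by positivity)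
    filter_upwards [tendsto_natCast_atTop_atTop.eventually h] with n hn
    exact (le_abs_self _).trans (by simpa using hn)
  filter_upwards [hk, hexp, hlin, hlog.eventually_ge_atTop 100, hloglog.eventually_ge_atTop 1,
    hloglog.eventually_ge_atTop (20 * Real.log C), eventually_ge_atTop 1]
    with n ⟨hk1, hkn⟩ hexp hlin hl hll hllC hn
  set l := Real.log n with hldef
  set η := Real.exp (-l / 3) with hη
  have hη1 : η ≤ 1 := by rw [hη, Real.exp_le_one_iff]; linarith
  obtain ⟨a, b, α, β, ν, w, r, hfα, hfβ, hfν, ha, hb, hab, hsum, hα, hβ, hν, hwr, hw, hαa, hβb⟩ :=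
    hdec η (Real.exp_pos _) hη1
  have hwpos : 0 < w := by
    rw [← NNReal.coe_pos, hw]; positivity
  have hn0 : (0 : ℝ) < n := by exact_mod_cast hn
  have hsmall := smallness_of_lt_one hA hk1 hR hδ (Real.exp_pos _).le (le_max_right 1 _)
    (two_mul_pow_mul_self_pow_mul_exp_lt_one (le_max_left 1 _) hk1 hkn hllC hll hl)
  refine (measure_small_le hY hindep hμ (Nat.le_mul_of_pos_left (k n) hA) hR ha hb hδ hab
    (Real.exp_pos _).le hη1 (Real.exp_le_exp.2 (by linarith)) hsmall hsum hwpos hwr hα hβ hν hαa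
    hβb n).trans (ENNReal.ofReal_le_ofReal ?_)
  have hk0 : (0 : ℝ) < k n := by exact_mod_cast hk1
  have hkl : (k n : ℝ) ≤ l := by
    have := (le_div_iff₀ (by positivity)).1 hkn
    nlinarith
  have hfirst : (k n : ℝ) / ((A * k n : ℕ) + 1) ≤ 1 / A := by
    rw [div_le_div_iff₀ (by positivity) hA0]
    push_cast; linarith
  have hsqrt : √c * Real.exp (1 / 6 * l) ≤ √(2 * w * (n + 1)) := by
    refine Real.le_sqrt_of_sq_le ?_
    have hnl : (n : ℝ) = Real.exp l := (Real.exp_log hn0).symm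
    rw [mul_pow, Real.sq_sqrt hc.le, hw, hη, ← Real.exp_nat_mul, ← Real.exp_nat_mul]
    have e : Real.exp ((2 : ℕ) * (1 / 6 * l)) = Real.exp ((2 : ℕ) * (-l / 3)) * n := by
      rw [hnl, ← Real.exp_add]; congr 1; push_cast; ring
    rw [e]
    have hpos : 0 < c * Real.exp ((2 : ℕ) * (-l / 3)) := by positivity
    nlinarith
  have hsecond : 2 * ((A * k n : ℕ) : ℝ) / √(2 * w * (n + 1)) ≤ 1 / A := by
    have hs : 0 < √c * Real.exp (1 / 6 * l) := by positivity
    rw [div_le_div_iff₀ (hs.trans_le hsqrt) hA0]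
    push_cast
    calc 2 * (A * k n : ℝ) * A = 2 * A ^ 2 * k n := by ring
      _ ≤ 2 * A ^ 2 * l := by gcongr
      _ ≤ _ := by linarith
  calc _ ≤ 1 / (A : ℝ) + 1 / A := add_le_add hfirst hsecond
    _ = 2 / A := by ring

theorem lemma1p2 {Ω : Type*} [MeasurableSpace Ω] (P : Measure Ω) [IsProbabilityMeasure P]
    (Y : ℕ → Ω → ℂ)
    (hindep : iIndepFun Y P)
    (hident : ∀ i, IdentDistrib (Y i) (Y 0) P P)
    (hnondeg : ¬ ∃ c : ℂ, ∀ᵐ ω ∂P, Y 0 ω = c)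
    (k : ℕ → ℕ)
    (hk : ∀ᶠ n : ℕ in atTop,
      1 ≤ k n ∧ (k n : ℝ) ≤ Real.log (n : ℝ) / (5 * Real.log (Real.log (n : ℝ))))
    (ε : ℝ) (hε : 0 < ε) :
    Tendsto
      (fun n : ℕ =>
        P {ω | ‖∑ S ∈ (Finset.range n).powersetCard (k n), ∏ i ∈ S, Y i ω‖
          ≤ Real.exp (-ε * (n : ℝ))})
      atTop (𝓝 0) := by
  have hae : ∀ i, AEMeasurable (Y i) P := fun i => (hident i).aemeasurable_fst
  -- everywhere measurable versions of the variables
  set Z : ℕ → Ω → ℂ := fun i => (hae i).mk (Y i) with hZ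
  have hYZ : ∀ i, Y i =ᵐ[P] Z i := fun i => (hae i).ae_eq_mk
  have hZm : ∀ i, Measurable (Z i) := fun i => (hae i).measurable_mk
  have hZlaw : ∀ i, P.map (Z i) = P.map (Y 0) := fun i => by
    rw [← Measure.map_congr (hYZ i), (hident i).map_eq]
  have hprob : IsProbabilityMeasure (P.map (Y 0)) := Measure.isProbabilityMeasure_map (hae 0)
  have hnd : ¬ ∃ c : ℂ, ∀ᵐ y ∂(P.map (Y 0)), y = c := fun ⟨c, hc⟩ =>
    hnondeg ⟨c, ae_of_ae_map (hae 0) hc⟩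
  have hset : ∀ n : ℕ, P {ω | ‖∑ S ∈ (Finset.range n).powersetCard (k n), ∏ i ∈ S, Y i ω‖
      ≤ Real.exp (-ε * (n : ℝ))} =
      P {ω | ‖∑ S ∈ (Finset.range n).powersetCard (k n), ∏ i ∈ S, Z i ω‖
      ≤ Real.exp (-ε * (n : ℝ))} := fun n => by
    refine measure_congr ?_
    filter_upwards [ae_all_iff.2 hYZ] with ω hω
    refine propext ?_
    change ‖∑ S ∈ (Finset.range n).powersetCard (k n), ∏ i ∈ S, Y i ω‖ ≤ _ ↔
      ‖∑ S ∈ (Finset.range n).powersetCard (k n), ∏ i ∈ S, Z i ω‖ ≤ _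
    simp only [hω]
  simp only [hset]
  rw [ENNReal.tendsto_nhds_zero]
  intro τ hτ
  have hA : Tendsto (fun A : ℕ => ENNReal.ofReal (2 / A)) atTop (𝓝 0) := by
    simpa using ENNReal.tendsto_ofReal (tendsto_const_div_atTop_nhds_zero_nat (2 : ℝ))
  obtain ⟨A, hAτ, hA1⟩ := ((ENNReal.tendsto_nhds_zero.1 hA τ hτ).and (eventually_ge_atTop 1)).exists
  filter_upwards [eventually_measure_small_le hZm (hindep.congr hYZ) hZlaw hnd hk hε hA1] with n hn
  exact hn.trans hAτ
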